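/- Let $n\ge 2$ and let $X=\mathbb P^1\times\mathbb P^{n-1}\times\mathbb P^{n-1}$, embedded by the Segre embedding in $\mathbb P(\mathbb C^2\otimes\mathbb C^n\otimes\mathbb C^n)=\mathbb P^{2n^2-1}$, which we identify with its dual space by letting the point $[h_{ijk}]$ stand for the hyperplane $\sum h_{ijk}x_{ijk}=0$. Let $\tau(X)$ be the tangential variety of $X$ (the Zariski closure of the union of the embedded projective tangent spaces of $X$), let $\sigma_r(X)$ be the $r$th secant variety (the Zariski closure of the union of the linear spans of $r$ points of $X$, with $\sigma_0(X)=\emptyset$), let $\tau(X)+\sigma_{n-2}(X)$ be their join (the Zariski closure of the union of the lines spanned by a point of $\tau(X)$ and a point of $\sigma_{n-2}(X)$, understood as $\tau(X)$ for $n=2$), and let $X^\vee$ be the dual variety of $X$ (the Zariski closure of the set of hyperplanes containing the tangent space of $X$ at some point). Then $$\tau(X)+\sigma_{n-2}(X)=X^\vee ,$$ and this variety is an irreducible hypersurface, namely the zero set of an irreducible homogeneous polynomial (the $2\times n\times n$ hyperdeterminant). -/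

import Mathlib

/-- The projective space with homogeneous coordinates indexed by `ι`, over `ℂ`. -/
abbrev CProj (ι : Type) : Type := Projectivization ℂ (ι → ℂ)

namespace ProjVar

variable {ι : Type} [Fintype ι]

/-- `f` is a homogeneous form vanishing on the set `Y` of points of projective space
(for a homogeneous `f`, vanishing does not depend on the chosen representatives). -/
def VanishesOn (f : MvPolynomial ι ℂ) (Y : Set (CProj ι)) : Prop :=
  (∃ d : ℕ, f.IsHomogeneous d) ∧ ∀ q ∈ Y, MvPolynomial.eval q.rep f = 0

/-- The closure of `Y` in the Zariski topology of projective space. -/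
def zariskiClosure (Y : Set (CProj ι)) : Set (CProj ι) :=
  {p | ∀ f : MvPolynomial ι ℂ, VanishesOn f Y → MvPolynomial.eval p.rep f = 0}

/-- The zero set of a form `F` in projective space (used for homogeneous `F`). -/
def zeroSet (F : MvPolynomial ι ℂ) : Set (CProj ι) :=
  {p | MvPolynomial.eval p.rep F = 0}

/-- The set `Y` is an irreducible hypersurface: the zero set of an irreducible form. -/
def IsIrreducibleHypersurface (Y : Set (CProj ι)) : Prop :=
  ∃ (F : MvPolynomial ι ℂ) (d : ℕ), F.IsHomogeneous d ∧ Irreducible F ∧ Y = zeroSet F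

/-- The embedded tangent space to `X` at `x`, as a linear subspace of the space of homogeneous
coordinates: the common kernel of the differentials at `x` of all forms vanishing on `X`. -/
noncomputable def tangentSpace (X : Set (CProj ι)) (x : CProj ι) : Submodule ℂ (ι → ℂ) where
  carrier := {v | ∀ f : MvPolynomial ι ℂ, VanishesOn f X →
    ∑ i, MvPolynomial.eval x.rep (MvPolynomial.pderiv i f) * v i = 0}
  zero_mem' := fun f _ => by simp
  add_mem' := fun {v w} hv hw f hf => by
    simp only [Pi.add_apply, mul_add, Finset.sum_add_distrib, hv f hf, hw f hf, add_zero]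
  smul_mem' := fun c v hv f hf => by
    simp only [Pi.smul_apply, smul_eq_mul, mul_left_comm _ c, ← Finset.mul_sum, hv f hf, mul_zero]

/-- The tangential variety of a smooth variety `X`: the Zariski closure of the union of all
embedded tangent spaces. -/
def tangentialVariety (X : Set (CProj ι)) : Set (CProj ι) :=
  zariskiClosure {p | ∃ x ∈ X, p.submodule ≤ tangentSpace X x}

/-- The `r`th secant variety: the Zariski closure of the union of the linear spans of `r` points
of `X`. For `r = 0` it is empty, and for `r = 1` it is the closure of `X`. -/
def secantVariety (r : ℕ) (X : Set (CProj ι)) : Set (CProj ι) :=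
  zariskiClosure {p | ∃ x : Fin r → CProj ι, (∀ i, x i ∈ X) ∧
    p.submodule ≤ ⨆ i, (x i).submodule}

/-- The join of `Y` and `Z`: the Zariski closure of the union of all lines spanned by a point of
`Y` and a point of `Z`. The sets `Y` and `Z` lie in this union unless one of them is empty; they
are added so that the join of `Y` with the empty set is the closure of `Y`. -/
def join (Y Z : Set (CProj ι)) : Set (CProj ι) :=
  zariskiClosure (Y ∪ Z ∪ {p | ∃ y ∈ Y, ∃ z ∈ Z, p.submodule ≤ y.submodule ⊔ z.submodule})

/-- The dual variety of a smooth variety `X`: the Zariski closure of the set of hyperplanes that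
contain the tangent space to `X` at some point. A projective space is identified with its dual by
letting `h` stand for the hyperplane `∑ i, h i * v i = 0`. -/
def dualVariety (X : Set (CProj ι)) : Set (CProj ι) :=
  zariskiClosure {h | ∃ x ∈ X, ∀ v ∈ tangentSpace X x, ∑ i, h.rep i * v i = 0}

/-- The coordinates `a i * b j * c k` of the decomposable tensor `a ⊗ b ⊗ c`. -/
def pureTensor {l m n : ℕ} (a : Fin l → ℂ) (b : Fin m → ℂ) (c : Fin n → ℂ) :
    Fin l × Fin m × Fin n → ℂ :=
  fun t => a t.1 * b t.2.1 * c t.2.2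

/-- The Segre variety, the image of the Segre embedding of the product of the projective spaces
of `ℂ^l`, `ℂ^m`, `ℂ^n` into the projective space of `l × m × n` arrays. -/
def segre (l m n : ℕ) : Set (CProj (Fin l × Fin m × Fin n)) :=
  {p | ∃ (a : CProj (Fin l)) (b : CProj (Fin m)) (c : CProj (Fin n))
    (h : pureTensor a.rep b.rep c.rep ≠ 0),
    p = Projectivization.mk ℂ (pureTensor a.rep b.rep c.rep) h}

end ProjVar

/-! Write n = m + 2. The proof squeezes the dual variety between two parametrised cones of arrays,
`tangentSecantSet` ⊆ `contractionSet` ⊆ `degenerateSet`. The first underlies the join. The second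
consists of the arrays orthogonal to some tangent space of the Segre variety, so it underlies the
dual variety. The third relaxes the second by allowing singular changes of coordinates, which makes
it the image of a polynomial map.

The two outer sets are images of affine spaces, so their ideals are prime
(`isPrime_vanishingIdeal_range`). The ideal of `degenerateSet` is nonzero: the determinant of the
pencil of such an array has a double root, so its discriminant vanishes
(`vanishingIdeal_degenerateSet_ne_bot`). The ideal of `tangentSecantSet` contains no nonzero
polynomial free of one chosen coordinate: adding a multiple of that coordinate vector to the family
gives a submersion at a suitable point (`range_fderiv_extendedFamily`). Both properties pass along
the inclusion of ideals, so each ideal is generated by one irreducible polynomial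
(`exists_irreducible_span`). One generator divides the other, so the ideals coincide, and their
generator F cuts out both the join and the dual variety.

Closures are handled near a base parameter where all vectors involved are nonzero: a form vanishing
on the arrays with parameters near it vanishes on the whole family. -/

namespace ProjVar

/-! ### Prime ideals of parametrised sets, principal ideals, homogeneity -/

section General

open MvPolynomial

lemma eval_aeval {T P : Type} (φ : T → MvPolynomial P ℂ) (f : MvPolynomial T ℂ) (p : P → ℂ) :
    eval p (aeval φ f) = eval (fun t => eval p (φ t)) f := by
  induction f using MvPolynomial.induction_on with
  | C a => simp
  | add f g hf hg => simp only [map_add, hf, hg]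
  | mul_X f t hf => simp only [map_mul, hf, aeval_X, eval_X]

/-- The polynomials vanishing on the image of a polynomial map form a prime ideal. -/
lemma isPrime_vanishingIdeal_range {T P : Type} (φ : T → MvPolynomial P ℂ) :
    (vanishingIdeal ℂ (Set.range fun (p : P → ℂ) t => eval p (φ t))).IsPrime := by
  have h : vanishingIdeal ℂ (Set.range fun (p : P → ℂ) t => eval p (φ t)) =
      RingHom.ker (aeval φ : MvPolynomial T ℂ →ₐ[ℂ] MvPolynomial P ℂ) := by
    ext f
    simp only [mem_vanishingIdeal_iff, Set.forall_mem_range, RingHom.mem_ker]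
    constructor
    · intro hf
      refine MvPolynomial.funext fun p => ?_
      rw [eval_aeval, map_zero]
      exact hf p
    · intro hf p
      have := eval_aeval φ f p
      rw [hf, map_zero] at this
      exact this.symm
  rw [h]
  exact RingHom.ker_isPrime _

/-- A nonzero prime ideal of `R[X]` which does not meet `R` is generated by an irreducible
polynomial. -/
lemma exists_irreducible_span_of_comap_C_eq_bot {R : Type*} [CommRing R] [IsDomain R]
    [UniqueFactorizationMonoid R] (J : Ideal (Polynomial R)) [hJ : J.IsPrime] (h0 : J ≠ ⊥)
    (hC : ∀ r : R, Polynomial.C r ∈ J → r = 0) :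
    ∃ F, Irreducible F ∧ J = Ideal.span {F} := by
  obtain ⟨F, hFJ, hF⟩ := hJ.exists_mem_prime_of_ne_bot h0
  refine ⟨F, hF.irreducible, le_antisymm (fun G hG => ?_) ?_⟩
  swap
  · rwa [Ideal.span_le, Set.singleton_subset_iff]
  rw [Ideal.mem_span_singleton]
  let : NormalizedGCDMonoid R := Nonempty.some inferInstance
  have hdeg : F.natDegree ≠ 0 := by
    intro h
    rw [Polynomial.natDegree_eq_zero] at h
    obtain ⟨r, rfl⟩ := h
    exact hF.ne_zero (by rw [hC r hFJ, map_zero])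
  have hprim : F.IsPrimitive := hF.irreducible.isPrimitive hdeg
  let K := FractionRing R
  -- If F did not divide G, they would be coprime over the fraction field. Clearing denominators in
  -- a Bézout relation then puts the nonzero constant `c * d` in J.
  by_contra hdvd
  have hirr : Irreducible (F.map (algebraMap R K)) :=
    hprim.irreducible_iff_irreducible_map_fraction_map.1 hF.irreducible
  have hcop : IsCoprime (F.map (algebraMap R K)) (G.map (algebraMap R K)) :=
    (hirr.coprime_iff_not_dvd).2 fun h => hdvd (hprim.dvd_of_fraction_map_dvd_fraction_map h)
  obtain ⟨u, v, huv⟩ := hcop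
  obtain ⟨c, hc0, hc⟩ := IsLocalization.integerNormalization_spec (nonZeroDivisors R) u
  obtain ⟨d, hd0, hd⟩ := IsLocalization.integerNormalization_spec (nonZeroDivisors R) v
  set u' := IsLocalization.integerNormalization (nonZeroDivisors R) u
  set v' := IsLocalization.integerNormalization (nonZeroDivisors R) v
  have hmem : Polynomial.C (c * d) ∈ J := by
    have : Polynomial.C (c * d) = Polynomial.C d * u' * F + Polynomial.C c * v' * G := by
      apply Polynomial.map_injective (algebraMap R K) (IsFractionRing.injective R K)
      have hu' : u'.map (algebraMap R K) = Polynomial.C (algebraMap R K c) * u := by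
        rw [hc, ← algebraMap_smul K c u, Polynomial.smul_eq_C_mul]
      have hv' : v'.map (algebraMap R K) = Polynomial.C (algebraMap R K d) * v := by
        rw [hd, ← algebraMap_smul K d v, Polynomial.smul_eq_C_mul]
      simp only [Polynomial.map_add, Polynomial.map_mul, Polynomial.map_C, hu', hv', map_mul]
      linear_combination (-(Polynomial.C (algebraMap R K c) * Polynomial.C (algebraMap R K d))) *
        huv
    rw [this]
    exact J.add_mem (J.mul_mem_left _ hFJ) (J.mul_mem_left _ hG)
  exact mul_ne_zero (nonZeroDivisors.ne_zero hc0) (nonZeroDivisors.ne_zero hd0) (hC _ hmem)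

/-- A nonzero prime ideal of a polynomial ring which contains no nonzero polynomial in the
variables other than `t₀` is generated by an irreducible polynomial. -/
lemma exists_irreducible_span {T : Type} [DecidableEq T] (t₀ : T) (I : Ideal (MvPolynomial T ℂ))
    [hI : I.IsPrime] (h0 : I ≠ ⊥)
    (hC : ∀ r : MvPolynomial {t // t ≠ t₀} ℂ, rename Subtype.val r ∈ I → r = 0) :
    ∃ F, Irreducible F ∧ I = Ideal.span {F} := by
  let e : MvPolynomial T ℂ ≃ₐ[ℂ] Polynomial (MvPolynomial {t // t ≠ t₀} ℂ) :=
    (renameEquiv ℂ (Equiv.optionSubtypeNe t₀).symm).trans (optionEquivLeft ℂ _)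
  let g : Polynomial (MvPolynomial {t // t ≠ t₀} ℂ) →+* MvPolynomial T ℂ := e.symm.toRingEquiv
  have hg : ∀ r, g (Polynomial.C r) = rename Subtype.val r := by
    intro r
    change e.symm (Polynomial.C r) = _
    rw [AlgEquiv.symm_apply_eq]
    induction r using MvPolynomial.induction_on with
    | C a => simp [e]
    | add p q hp hq => simp only [map_add, hp, hq]
    | mul_X p i hp =>
      simp only [map_mul, hp, rename_X]
      congr 1
      simp [e, Equiv.optionSubtypeNe_symm_of_ne i.2]
  have hJ : (I.comap g).IsPrime := Ideal.comap_isPrime g I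
  obtain ⟨F, hF, hspan⟩ := exists_irreducible_span_of_comap_C_eq_bot (I.comap g) (by
      obtain ⟨f, hf, hf0⟩ := Submodule.exists_mem_ne_zero_of_ne_bot h0
      intro h
      have : e f ∈ I.comap g := by
        change e.symm (e f) ∈ I
        rwa [e.symm_apply_apply]
      rw [h, Ideal.mem_bot] at this
      exact hf0 (by simpa using this))
    (fun r hr => hC r (by rw [← hg]; exact hr))
  refine ⟨e.symm F, (MulEquiv.irreducible_iff e.symm).2 hF, ?_⟩
  ext f
  have h1 : f ∈ I ↔ e f ∈ I.comap g := by
    change f ∈ I ↔ e.symm (e f) ∈ I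
    rw [e.symm_apply_apply]
  rw [h1, hspan, Ideal.mem_span_singleton, Ideal.mem_span_singleton]
  rw [← map_dvd_iff e.symm, e.symm_apply_apply]

lemma eval_smul_of_isHomogeneous {T : Type} {f : MvPolynomial T ℂ} {d : ℕ}
    (hf : f.IsHomogeneous d) (c : ℂ) (x : T → ℂ) : eval (c • x) f = c ^ d * eval x f := by
  rw [eval_eq, eval_eq, Finset.mul_sum]
  refine Finset.sum_congr rfl fun s hs => ?_
  rw [hf.degree_eq_sum_deg_support hs]
  simp only [Pi.smul_apply, smul_eq_mul, mul_pow, Finset.prod_mul_distrib,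
    Finset.prod_pow_eq_pow_sum]
  ring

lemma eval_smul_eq_sum {T : Type} (f : MvPolynomial T ℂ) (c : ℂ) (x : T → ℂ) :
    eval (c • x) f = ∑ d ∈ Finset.range (f.totalDegree + 1),
      c ^ d * eval x (homogeneousComponent d f) := by
  conv_lhs => rw [← sum_homogeneousComponent f]
  rw [map_sum]
  refine Finset.sum_congr rfl fun d _ => ?_
  exact eval_smul_of_isHomogeneous (homogeneousComponent_isHomogeneous d f) c x

/-- A polynomial vanishing on all nonzero multiples of a vector has all its homogeneous components
vanishing at this vector. -/
lemma eval_homogeneousComponent_eq_zero {T : Type} (f : MvPolynomial T ℂ) (x : T → ℂ)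
    (h : ∀ c : ℂ, c ≠ 0 → eval (c • x) f = 0) (d : ℕ) :
    eval x (homogeneousComponent d f) = 0 := by
  let q : Polynomial ℂ := ∑ d ∈ Finset.range (f.totalDegree + 1),
    Polynomial.monomial d (eval x (homogeneousComponent d f))
  have hq : q = 0 := by
    apply Polynomial.eq_zero_of_infinite_isRoot
    refine Set.Infinite.mono (s := {0}ᶜ) (fun c hc => ?_) (Set.finite_singleton _).infinite_compl
    have := h c hc
    rw [eval_smul_eq_sum] at this
    simp only [Set.mem_ofPred_eq, Polynomial.IsRoot.def, q, Polynomial.eval_finsetSum,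
      Polynomial.eval_monomial]
    rw [← this]
    exact Finset.sum_congr rfl fun _ _ => mul_comm _ _
  by_cases hd : d < f.totalDegree + 1
  · have := congrArg (Polynomial.coeff · d) hq
    simpa [q, Polynomial.finsetSum_coeff, Polynomial.coeff_monomial, hd] using this
  · rw [homogeneousComponent_eq_zero d f (by omega), map_zero]

/-- If the ideal of a cone is principal, then its generator is homogeneous. -/
lemma exists_isHomogeneous_of_vanishingIdeal_eq_span {T : Type} (S : Set (T → ℂ))
    (hS : ∀ x ∈ S, ∀ c : ℂ, c • x ∈ S) (F : MvPolynomial T ℂ) (hF : F ≠ 0)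
    (h : vanishingIdeal ℂ S = Ideal.span {F}) : ∃ d, F.IsHomogeneous d := by
  -- On a cone every homogeneous component of F vanishes too, so F divides it. A nonzero component
  -- then has degree at least that of F, which leaves only the top one.
  have hmem : ∀ d, F ∣ homogeneousComponent d F := by
    intro d
    rw [← Ideal.mem_span_singleton, ← h, mem_vanishingIdeal_iff]
    intro x hx
    refine eval_homogeneousComponent_eq_zero F x (fun c _ => ?_) d
    have hFm : F ∈ vanishingIdeal ℂ S := by rw [h]; exact Ideal.mem_span_singleton_self F
    exact hFm _ (hS x hx c)
  have hle : ∀ d, homogeneousComponent d F ≠ 0 → F.totalDegree ≤ d := by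
    intro d hd
    obtain ⟨G, hG⟩ := hmem d
    have h1 := (homogeneousComponent_isHomogeneous d F).totalDegree hd
    have hG0 : G ≠ 0 := by rintro rfl; exact hd (by rw [hG, mul_zero])
    rw [hG, totalDegree_mul_of_isDomain hF hG0] at h1
    omega
  refine ⟨F.totalDegree, ?_⟩
  have : F = homogeneousComponent F.totalDegree F := by
    conv_lhs => rw [← sum_homogeneousComponent F]
    refine Finset.sum_eq_single_of_mem _ (by simp) fun d hd hne => ?_
    by_contra h0
    have := hle d h0
    simp only [Finset.mem_range] at hd
    omega
  have h2 := homogeneousComponent_isHomogeneous F.totalDegree F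
  rwa [← this] at h2

variable {ι : Type}

/-- A polynomial vanishing on the affine cone over `Y` vanishes on the affine cone over the
Zariski closure of `Y`. -/
lemma eval_smul_rep_eq_zero_of_mem_zariskiClosure {Y : Set (CProj ι)} {f : MvPolynomial ι ℂ}
    (hf : ∀ q ∈ Y, ∀ c : ℂ, eval (c • q.rep) f = 0) {p : CProj ι} (hp : p ∈ zariskiClosure Y)
    (c : ℂ) : eval (c • p.rep) f = 0 := by
  rw [eval_smul_eq_sum]
  refine Finset.sum_eq_zero fun d _ => ?_
  rw [hp (homogeneousComponent d f) ⟨⟨d, homogeneousComponent_isHomogeneous d f⟩, fun q hq => ?_⟩,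
    mul_zero]
  exact eval_homogeneousComponent_eq_zero f _ (fun c _ => hf q hq c) d

lemma zariskiClosure_eq_zeroSet {Y : Set (CProj ι)} {F : MvPolynomial ι ℂ} {d : ℕ}
    (hd : F.IsHomogeneous d) (hF : ∀ p ∈ Y, eval p.rep F = 0)
    (h : ∀ f, VanishesOn f Y → F ∣ f) : zariskiClosure Y = zeroSet F := by
  ext p
  constructor
  · exact fun hp => hp F ⟨⟨d, hd⟩, hF⟩
  · intro hp f hf
    obtain ⟨G, rfl⟩ := h f hf
    rw [map_mul, show eval p.rep F = 0 from hp, zero_mul]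

end General

/-! ### The hyperdeterminant as a discriminant, vanishing on degenerate arrays -/

section Discriminant

open MvPolynomial

/-- The array obtained from `l` by erasing all entries with two vanishing indices and then acting
with the matrices `g`, `u`, `v` on the three factors. -/
def degenerateArray {R : Type*} [CommRing R] {m : ℕ} (g : Fin 2 → Fin 2 → R)
    (u v : Fin (m + 2) → Fin (m + 2) → R) (l : Fin 2 × Fin (m + 2) × Fin (m + 2) → R)
    (t : Fin 2 × Fin (m + 2) × Fin (m + 2)) : R :=
  ∑ i, ∑ j, ∑ k, g t.1 i * u t.2.1 j * v t.2.2 k *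
    if (i = 0 ∧ j = 0) ∨ (i = 0 ∧ k = 0) ∨ (j = 0 ∧ k = 0) then 0 else l (i, j, k)

lemma map_degenerateArray {R S : Type*} [CommRing R] [CommRing S] (φ : R →+* S) {m : ℕ}
    (g : Fin 2 → Fin 2 → R) (u v : Fin (m + 2) → Fin (m + 2) → R)
    (l : Fin 2 × Fin (m + 2) × Fin (m + 2) → R) (t : Fin 2 × Fin (m + 2) × Fin (m + 2)) :
    φ (degenerateArray g u v l t) = degenerateArray (fun i j => φ (g i j))
      (fun i j => φ (u i j)) (fun i j => φ (v i j)) (fun s => φ (l s)) t := by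
  simp only [degenerateArray, map_sum, map_mul, apply_ite φ, map_zero]

/-- The `2 × n × n` arrays obtained from arrays with vanishing entries at all positions with two
vanishing indices. -/
def degenerateSet (m : ℕ) : Set (Fin 2 × Fin (m + 2) × Fin (m + 2) → ℂ) :=
  {h | ∃ g u v l, h = degenerateArray g u v l}

/-- The determinant of the pencil of matrices defined by a `2 × n × n` array. -/
noncomputable def pencilDet {R : Type*} [CommRing R] {n : ℕ} (h : Fin 2 × Fin n × Fin n → R) :
    Polynomial R :=
  ((Polynomial.X : Polynomial R) • (Matrix.of fun j k => h (1, j, k)).map Polynomial.C +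
    (Matrix.of fun j k => h (0, j, k)).map Polynomial.C).det

lemma natDegree_pencilDet_le {R : Type*} [CommRing R] {n : ℕ} (h : Fin 2 × Fin n × Fin n → R) :
    (pencilDet h).natDegree ≤ n := by
  simpa [pencilDet] using Polynomial.natDegree_det_X_add_C_le (Matrix.of fun j k => h (1, j, k))
    (Matrix.of fun j k => h (0, j, k))

lemma map_pencilDet {R S : Type*} [CommRing R] [CommRing S] (φ : R →+* S) {n : ℕ}
    (h : Fin 2 × Fin n × Fin n → R) : (pencilDet h).map φ = pencilDet fun t => φ (h t) := by
  rw [pencilDet, pencilDet, ← Polynomial.coe_mapRingHom, RingHom.map_det]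
  congr 1
  ext j k : 2
  simp [Matrix.map_apply]

/-- The hyperdeterminant as the discriminant of the determinant of a pencil. -/
noncomputable def pencilDiscr {R : Type*} [CommRing R] {n : ℕ} (h : Fin 2 × Fin n × Fin n → R) :
    R :=
  (pencilDet h).resultant (Polynomial.derivative (pencilDet h)) n (n - 1)

/-- This holds because the resultant is taken with the formal degrees n and n - 1, which do not drop
when the leading coefficient maps to zero. It lets one polynomial be evaluated at every array. -/
lemma map_pencilDiscr {R S : Type*} [CommRing R] [CommRing S] (φ : R →+* S) {n : ℕ}
    (h : Fin 2 × Fin n × Fin n → R) : φ (pencilDiscr h) = pencilDiscr fun t => φ (h t) := by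
  rw [pencilDiscr, pencilDiscr, ← map_pencilDet φ, Polynomial.derivative_map,
    Polynomial.resultant_map_map]

lemma det_eq_sq_mul {R : Type*} [CommRing R] {n : ℕ} (N : Matrix (Fin (n + 1)) (Fin (n + 1)) R)
    (N' : Matrix (Fin (n + 1)) (Fin (n + 1)) R) (s : R)
    (h : ∀ j k, N j k = (if j = 0 then s else 1) * N' j k * (if k = 0 then s else 1)) :
    N.det = s ^ 2 * N'.det := by
  have : N = Matrix.diagonal (fun j => if j = 0 then s else 1) * N' *
      Matrix.diagonal (fun j => if j = 0 then s else 1) := by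
    ext j k
    rw [Matrix.mul_diagonal, Matrix.diagonal_mul, h]
  rw [this, Matrix.det_mul, Matrix.det_mul, Matrix.det_diagonal]
  simp only [Finset.prod_ite_eq', Finset.mem_univ, if_true]
  ring

/-- The matrices u and v factor out of the determinant. In the remaining matrix `N` the corner is
zero and only i = 1 contributes to row 0 and column 0, so both are divisible by `r 1`, giving two
factors. -/
lemma sq_dvd_pencilDet {R : Type*} [CommRing R] {m : ℕ} (g : Fin 2 → Fin 2 → R)
    (u v : Fin (m + 2) → Fin (m + 2) → R) (l : Fin 2 × Fin (m + 2) × Fin (m + 2) → R) :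
    (Polynomial.C (g 0 1) + Polynomial.X * Polynomial.C (g 1 1)) ^ 2 ∣
      pencilDet (degenerateArray g u v l) := by
  let r : Fin 2 → Polynomial R := fun i =>
    Polynomial.C (g 0 i) + Polynomial.X * Polynomial.C (g 1 i)
  let N : Matrix (Fin (m + 2)) (Fin (m + 2)) (Polynomial R) := fun j k =>
    ∑ i, r i * if (i = 0 ∧ j = 0) ∨ (i = 0 ∧ k = 0) ∨ (j = 0 ∧ k = 0) then 0 else
      Polynomial.C (l (i, j, k))
  let N' : Matrix (Fin (m + 2)) (Fin (m + 2)) (Polynomial R) := fun j k =>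
    if j = 0 ∧ k = 0 then 0 else if j = 0 ∨ k = 0 then Polynomial.C (l (1, j, k)) else N j k
  have hN : N.det = r 1 ^ 2 * N'.det := by
    refine det_eq_sq_mul N N' (r 1) fun j k => ?_
    by_cases hj : j = 0 <;> by_cases hk : k = 0 <;> simp [N, N', hj, hk, mul_comm]
  have : pencilDet (degenerateArray g u v l) =
      ((Matrix.of u).map Polynomial.C * N * ((Matrix.of v).map Polynomial.C).transpose).det := by
    rw [pencilDet]
    congr 1
    ext1 j k
    simp only [Matrix.mul_apply, Matrix.add_apply, Matrix.smul_apply, Matrix.map_apply,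
      Matrix.of_apply, Matrix.transpose_apply, degenerateArray, map_sum, smul_eq_mul]
    simp only [N, r, Finset.sum_mul, Finset.mul_sum]
    symm
    refine (Finset.sum_congr rfl fun k _ => Finset.sum_comm).trans (Finset.sum_comm.trans ?_)
    rw [← Finset.sum_add_distrib]
    refine Finset.sum_congr rfl fun i _ => Finset.sum_comm.trans ?_
    rw [← Finset.sum_add_distrib]
    refine Finset.sum_congr rfl fun j _ => ?_
    rw [← Finset.sum_add_distrib]
    refine Finset.sum_congr rfl fun k _ => ?_
    simp only [map_mul, apply_ite Polynomial.C, map_zero]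
    ring
  rw [this, Matrix.det_mul, Matrix.det_mul, hN]
  exact ((dvd_mul_right _ _).mul_left _).mul_right _

lemma pencilDiscr_degenerateArray {m : ℕ} (g : Fin 2 → Fin 2 → ℂ)
    (u v : Fin (m + 2) → Fin (m + 2) → ℂ) (l : Fin 2 × Fin (m + 2) × Fin (m + 2) → ℂ)
    (hg : g 1 1 ≠ 0) : pencilDiscr (degenerateArray g u v l) = 0 := by
  set p := pencilDet (degenerateArray g u v l) with hp
  obtain ⟨q, hq⟩ := sq_dvd_pencilDet g u v l
  have hdeg : p.natDegree ≤ m + 2 := natDegree_pencilDet_le _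
  obtain ⟨a, b, -, -, hab⟩ := Polynomial.exists_mul_add_mul_eq_C_resultant p
    (Polynomial.derivative p) hdeg
    ((Polynomial.natDegree_derivative_le p).trans (Nat.sub_le_sub_right hdeg 1)) (by simp)
  -- The resultant is a combination of the polynomial and its derivative, and both vanish at this
  -- double root, which is finite because `g 1 1` is nonzero.
  have h := congrArg (Polynomial.eval (-g 0 1 / g 1 1)) hab
  have h0 : g 0 1 + g 1 1 * (-g 0 1 / g 1 1) = 0 := by field_simp; ring
  rw [Polynomial.eval_C] at h
  rw [pencilDiscr, ← hp, ← h]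
  rw [hp, hq]
  simp [Polynomial.derivative_mul, Polynomial.derivative_pow, h0]

/-- A diagonal pencil with the distinct roots 0, …, n - 1 is a witness. -/
lemma exists_pencilDiscr_ne_zero (n : ℕ) :
    ∃ h : Fin 2 × Fin n × Fin n → ℂ, pencilDiscr h ≠ 0 := by
  let h : Fin 2 × Fin n × Fin n → ℂ := fun t =>
    if t.2.1 = t.2.2 then (if t.1 = 0 then -(t.2.1 : ℂ) else 1) else 0
  have hp : pencilDet h = ∏ i : Fin n, (Polynomial.X - Polynomial.C ((i : ℕ) : ℂ)) := by
    rw [pencilDet, ← Matrix.det_diagonal]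
    congr 1
    ext1 j k
    by_cases hjk : j = k
    · subst hjk
      simp [h, sub_eq_add_neg]
    · simp [h, hjk]
  have hdeg : (pencilDet h).natDegree = n := by
    rw [hp, Polynomial.natDegree_prod_of_monic _ _ fun i _ => Polynomial.monic_X_sub_C _]
    simp only [Polynomial.natDegree_X_sub_C, Finset.sum_const, Finset.card_univ, Fintype.card_fin,
      smul_eq_mul, mul_one]
  have hsep : (pencilDet h).Separable := by
    rw [hp, Polynomial.separable_prod_X_sub_C_iff]
    intro i j hij
    exact Fin.val_injective (Nat.cast_injective hij)
  refine ⟨h, ?_⟩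
  -- The determinant is monic of degree n, so the formal degrees in `pencilDiscr` are the actual
  -- ones.
  have h1 := Polynomial.resultant_ne_zero _ _ hsep
  rwa [Polynomial.natDegree_derivative, hdeg] at h1

/-- The index set of the parameters of `degenerateArray`. -/
abbrev DegenerateParam (m : ℕ) : Type :=
  (Fin 2 × Fin 2) ⊕ (Fin (m + 2) × Fin (m + 2)) ⊕ (Fin (m + 2) × Fin (m + 2)) ⊕
    (Fin 2 × Fin (m + 2) × Fin (m + 2))

/-- The array `degenerateArray` with the parameters as coordinates. -/
def degenerateFamily {R : Type*} [CommRing R] (m : ℕ) (p : DegenerateParam m → R) :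
    Fin 2 × Fin (m + 2) × Fin (m + 2) → R :=
  degenerateArray (fun i j => p (.inl (i, j))) (fun i j => p (.inr (.inl (i, j))))
    (fun i j => p (.inr (.inr (.inl (i, j))))) (fun t => p (.inr (.inr (.inr t))))

lemma eval_degenerateFamily {m : ℕ} (p : DegenerateParam m → ℂ)
    (t : Fin 2 × Fin (m + 2) × Fin (m + 2)) :
    eval p (degenerateFamily m (X : DegenerateParam m → MvPolynomial (DegenerateParam m) ℂ) t) =
      degenerateFamily m p t := by
  rw [degenerateFamily, map_degenerateArray]
  simp only [eval_X]
  rfl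

lemma degenerateSet_eq_range (m : ℕ) : degenerateSet m = Set.range fun p t =>
    eval p (degenerateFamily m (X : DegenerateParam m → MvPolynomial (DegenerateParam m) ℂ) t) := by
  ext h
  simp only [eval_degenerateFamily]
  constructor
  · rintro ⟨g, u, v, l, rfl⟩
    exact ⟨Sum.elim (fun x => g x.1 x.2) (Sum.elim (fun x => u x.1 x.2)
      (Sum.elim (fun x => v x.1 x.2) l)), rfl⟩
  · rintro ⟨p, rfl⟩
    exact ⟨_, _, _, _, rfl⟩

instance (m : ℕ) : (vanishingIdeal ℂ (degenerateSet m)).IsPrime := by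
  rw [degenerateSet_eq_range]
  exact isPrime_vanishingIdeal_range _

lemma vanishingIdeal_degenerateSet_ne_bot (m : ℕ) : vanishingIdeal ℂ (degenerateSet m) ≠ ⊥ := by
  let D : MvPolynomial (Fin 2 × Fin (m + 2) × Fin (m + 2)) ℂ := pencilDiscr X
  have hD : ∀ h, eval h D = pencilDiscr h := fun h => by
    simp only [D, map_pencilDiscr, eval_X]
  have hD0 : D ≠ 0 := by
    obtain ⟨h, hh⟩ := exists_pencilDiscr_ne_zero (m + 2)
    rintro h0
    rw [← hD, h0, map_zero] at hh
    exact hh rfl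
  refine Submodule.ne_bot_iff _ |>.2 ⟨D, ?_, hD0⟩
  let Q := pencilDiscr
    (degenerateFamily m (X : DegenerateParam m → MvPolynomial (DegenerateParam m) ℂ))
  have hQ : ∀ p, eval p Q = pencilDiscr (degenerateFamily m p) := fun p => by
    simp only [Q, map_pencilDiscr, eval_degenerateFamily]
  have hQ0 : Q = 0 := by
    -- The factor removes the condition `g 1 1 ≠ 0`; it cancels because the polynomial ring is a
    -- domain.
    have : Q * X (.inl (1, 1)) = 0 := by
      refine MvPolynomial.funext fun p => ?_
      rw [map_mul, map_zero, hQ, eval_X]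
      by_cases hp : p (.inl (1, 1)) = 0
      · rw [hp, mul_zero]
      · rw [degenerateFamily, pencilDiscr_degenerateArray _ _ _ _ hp, zero_mul]
    exact (mul_eq_zero.1 this).resolve_right (X_ne_zero _)
  rw [degenerateSet_eq_range, mem_vanishingIdeal_iff, Set.forall_mem_range]
  intro p
  simp only [eval_degenerateFamily]
  change eval _ D = 0
  rw [hD, ← hQ, hQ0, map_zero]

end Discriminant

/-! ### Multilinearity of decomposable tensors -/

section PureTensor

variable {l m n : ℕ}

lemma pureTensor_add_left (a a' : Fin l → ℂ) (b : Fin m → ℂ) (c : Fin n → ℂ) :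
    pureTensor (a + a') b c = pureTensor a b c + pureTensor a' b c := by
  ext t; simp only [pureTensor, Pi.add_apply]; ring

lemma pureTensor_add_mid (a : Fin l → ℂ) (b b' : Fin m → ℂ) (c : Fin n → ℂ) :
    pureTensor a (b + b') c = pureTensor a b c + pureTensor a b' c := by
  ext t; simp only [pureTensor, Pi.add_apply]; ring

lemma pureTensor_add_right (a : Fin l → ℂ) (b : Fin m → ℂ) (c c' : Fin n → ℂ) :
    pureTensor a b (c + c') = pureTensor a b c + pureTensor a b c' := by
  ext t; simp only [pureTensor, Pi.add_apply]; ring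

lemma pureTensor_smul_left (s : ℂ) (a : Fin l → ℂ) (b : Fin m → ℂ) (c : Fin n → ℂ) :
    pureTensor (s • a) b c = s • pureTensor a b c := by
  ext t; simp only [pureTensor, Pi.smul_apply, smul_eq_mul]; ring

lemma pureTensor_smul_mid (s : ℂ) (a : Fin l → ℂ) (b : Fin m → ℂ) (c : Fin n → ℂ) :
    pureTensor a (s • b) c = s • pureTensor a b c := by
  ext t; simp only [pureTensor, Pi.smul_apply, smul_eq_mul]; ring

lemma pureTensor_smul_right (s : ℂ) (a : Fin l → ℂ) (b : Fin m → ℂ) (c : Fin n → ℂ) :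
    pureTensor a b (s • c) = s • pureTensor a b c := by
  ext t; simp only [pureTensor, Pi.smul_apply, smul_eq_mul]; ring

@[simp] lemma pureTensor_zero_left (b : Fin m → ℂ) (c : Fin n → ℂ) :
    pureTensor (0 : Fin l → ℂ) b c = 0 := by
  ext t; simp [pureTensor]

@[simp] lemma pureTensor_zero_mid (a : Fin l → ℂ) (c : Fin n → ℂ) :
    pureTensor a (0 : Fin m → ℂ) c = 0 := by
  ext t; simp [pureTensor]

@[simp] lemma pureTensor_zero_right (a : Fin l → ℂ) (b : Fin m → ℂ) :
    pureTensor a b (0 : Fin n → ℂ) = 0 := by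
  ext t; simp [pureTensor]

lemma pureTensor_single (i : Fin l) (j : Fin m) (k : Fin n) :
    pureTensor (Pi.single i 1) (Pi.single j 1) (Pi.single k 1) = Pi.single (i, j, k) 1 := by
  ext ⟨i', j', k'⟩
  by_cases hi : i' = i <;> by_cases hj : j' = j <;> by_cases hk : k' = k <;>
    simp [pureTensor, hi, hj, hk]

end PureTensor

/-! ### The tangent-secant family has codimension at most one -/

section TangentSecant

open MvPolynomial Filter Topology

variable {m : ℕ}

/-- The sum of a tangent vector to the Segre variety at `a 0 ⊗ b 0 ⊗ c 0` and `m` further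
decomposable tensors. -/
def tangentSecantArray {R : Type*} [CommRing R] (a : Fin (m + 2) → Fin 2 → R)
    (b c : Fin (m + 2) → Fin (m + 2) → R) (t : Fin 2 × Fin (m + 2) × Fin (m + 2)) : R :=
  a 1 t.1 * b 0 t.2.1 * c 0 t.2.2 + a 0 t.1 * b 1 t.2.1 * c 0 t.2.2 +
    a 0 t.1 * b 0 t.2.1 * c 1 t.2.2 +
    ∑ i : Fin m, a i.succ.succ t.1 * b i.succ.succ t.2.1 * c i.succ.succ t.2.2

lemma map_tangentSecantArray {R S : Type*} [CommRing R] [CommRing S] (φ : R →+* S)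
    (a : Fin (m + 2) → Fin 2 → R) (b c : Fin (m + 2) → Fin (m + 2) → R)
    (t : Fin 2 × Fin (m + 2) × Fin (m + 2)) :
    φ (tangentSecantArray a b c t) = tangentSecantArray (fun i j => φ (a i j))
      (fun i j => φ (b i j)) (fun i j => φ (c i j)) t := by
  simp only [tangentSecantArray, map_add, map_sum, map_mul]

lemma tangentSecantArray_eq (a : Fin (m + 2) → Fin 2 → ℂ) (b c : Fin (m + 2) → Fin (m + 2) → ℂ) :
    tangentSecantArray a b c = pureTensor (a 1) (b 0) (c 0) + pureTensor (a 0) (b 1) (c 0) +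
      pureTensor (a 0) (b 0) (c 1) +
      ∑ i : Fin m, pureTensor (a i.succ.succ) (b i.succ.succ) (c i.succ.succ) := by
  ext t
  simp only [tangentSecantArray, pureTensor, Pi.add_apply, Finset.sum_apply]

/-- The arrays of the form `tangentSecantArray a b c`. -/
def tangentSecantSet (m : ℕ) : Set (Fin 2 × Fin (m + 2) × Fin (m + 2) → ℂ) :=
  {h | ∃ a b c, h = tangentSecantArray a b c}

/-- The index set of the parameters of `tangentSecantArray`. -/
abbrev TangentSecantParam (m : ℕ) : Type :=
  (Fin (m + 2) × Fin 2) ⊕ (Fin (m + 2) × Fin (m + 2)) ⊕ (Fin (m + 2) × Fin (m + 2))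

/-- The array `tangentSecantArray` with the parameters as coordinates. -/
def tangentSecantFamily {R : Type*} [CommRing R] (m : ℕ) (p : TangentSecantParam m → R) :
    Fin 2 × Fin (m + 2) × Fin (m + 2) → R :=
  tangentSecantArray (fun i j => p (.inl (i, j))) (fun i j => p (.inr (.inl (i, j))))
    (fun i j => p (.inr (.inr (i, j))))

/-- The parameters with given families of vectors. -/
def tangentSecantParam {R : Type*} (a : Fin (m + 2) → Fin 2 → R)
    (b c : Fin (m + 2) → Fin (m + 2) → R) : TangentSecantParam m → R :=
  Sum.elim (fun x => a x.1 x.2) (Sum.elim (fun x => b x.1 x.2) (fun x => c x.1 x.2))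

lemma eval_tangentSecantFamily (p : TangentSecantParam m → ℂ)
    (t : Fin 2 × Fin (m + 2) × Fin (m + 2)) :
    eval p (tangentSecantFamily m
      (X : TangentSecantParam m → MvPolynomial (TangentSecantParam m) ℂ) t) =
      tangentSecantFamily m p t := by
  rw [tangentSecantFamily, map_tangentSecantArray]
  simp only [eval_X]
  rfl

lemma tangentSecantSet_eq_range (m : ℕ) : tangentSecantSet m = Set.range fun p t =>
    eval p (tangentSecantFamily m
      (X : TangentSecantParam m → MvPolynomial (TangentSecantParam m) ℂ) t) := by
  ext h
  simp only [eval_tangentSecantFamily]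
  constructor
  · rintro ⟨a, b, c, rfl⟩
    exact ⟨tangentSecantParam a b c, rfl⟩
  · rintro ⟨p, rfl⟩
    exact ⟨_, _, _, rfl⟩

instance (m : ℕ) : (vanishingIdeal ℂ (tangentSecantSet m)).IsPrime := by
  rw [tangentSecantSet_eq_range]
  exact isPrime_vanishingIdeal_range _

lemma eq_zero_of_eventually_eval_eq_zero {σ : Type} [Fintype σ] (f : MvPolynomial σ ℂ) (x₀ : σ → ℂ)
    (h : ∀ᶠ x in 𝓝 x₀, eval x f = 0) : f = 0 := by
  obtain ⟨ε, hε, hball⟩ := Metric.eventually_nhds_iff_ball.1 h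
  refine funext_set (fun i => Metric.ball (x₀ i) ε) (fun i => ?_) fun x hx => ?_
  · exact infinite_of_mem_nhds (x₀ i) (Metric.ball_mem_nhds _ hε)
  · rw [map_zero]
    refine hball x ?_
    rwa [ball_pi _ hε]

/-- A linear algebra fact about the tangent space to the join of the tangential variety and a
secant variety. -/
lemma mem_of_tangentSecant_directions {V : Type*} [AddCommGroup V] [Module ℂ V]
    (W : Submodule ℂ V) (τ : Fin 2 → Fin (m + 2) → Fin (m + 2) → V)
    (hA1 : ∀ l, τ l 0 0 ∈ W) (hA0 : ∀ l, τ l 1 0 + τ l 0 1 ∈ W)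
    (hA : ∀ l (i : Fin m), τ l i.succ.succ i.succ.succ ∈ W)
    (hB1 : ∀ j, τ 0 j 0 ∈ W) (hC1 : ∀ k, τ 0 0 k ∈ W)
    (hB0 : ∀ j, τ 1 j 0 + τ 0 j 1 ∈ W) (hC0 : ∀ k, τ 1 0 k + τ 0 1 k ∈ W)
    (hB : ∀ j (i : Fin m), τ 0 j i.succ.succ + ((i : ℕ) + 2 : ℂ) • τ 1 j i.succ.succ ∈ W)
    (hC : ∀ k (i : Fin m), τ 0 i.succ.succ k + ((i : ℕ) + 2 : ℂ) • τ 1 i.succ.succ k ∈ W)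
    (hX : τ 1 1 1 ∈ W) (l : Fin 2) (j k : Fin (m + 2)) : τ l j k ∈ W := by
  have hsmul : ∀ (s : ℂ) (v : V), s ≠ 0 → s • v ∈ W → v ∈ W := fun s v hs h =>
    (W.smul_mem_iff hs).1 h
  have hne : ∀ i : Fin m, ((i : ℕ) + 2 : ℂ) ≠ 0 := fun i => by
    exact_mod_cast Nat.succ_ne_zero ((i : ℕ) + 1)
  -- Indices (1,1,0), (1,0,1), (0,1,1) occur only through their pairwise sums, which determine each
  -- of them since 2 is invertible.
  have h110 : τ 1 1 0 ∈ W := by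
    refine hsmul 2 _ two_ne_zero ?_
    have := W.sub_mem (W.add_mem (hA0 1) (hB0 1)) (hC0 1)
    convert this using 1
    module
  have h101 : τ 1 0 1 ∈ W := (W.add_mem_iff_right h110).1 (hA0 1)
  have h011 : τ 0 1 1 ∈ W := (W.add_mem_iff_right h110).1 (hB0 1)
  have hi0 : ∀ i : Fin m, τ 1 i.succ.succ 0 ∈ W := fun i =>
    hsmul _ _ (hne i) ((W.add_mem_iff_right (hB1 _)).1 (hC 0 i))
  have h0i : ∀ i : Fin m, τ 1 0 i.succ.succ ∈ W := fun i =>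
    hsmul _ _ (hne i) ((W.add_mem_iff_right (hC1 _)).1 (hB 0 i))
  have hi1 : ∀ i : Fin m, τ 0 i.succ.succ 1 ∈ W := fun i =>
    (W.add_mem_iff_right (hi0 i)).1 (hB0 _)
  have h1i : ∀ i : Fin m, τ 0 1 i.succ.succ ∈ W := fun i =>
    (W.add_mem_iff_right (h0i i)).1 (hC0 _)
  have hi1' : ∀ i : Fin m, τ 1 i.succ.succ 1 ∈ W := fun i =>
    hsmul _ _ (hne i) ((W.add_mem_iff_right (hi1 _)).1 (hC 1 i))
  have h1i' : ∀ i : Fin m, τ 1 1 i.succ.succ ∈ W := fun i =>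
    hsmul _ _ (hne i) ((W.add_mem_iff_right (h1i _)).1 (hB 1 i))
  have hij : ∀ i i' : Fin m, τ 1 i.succ.succ i'.succ.succ ∈ W := by
    intro i i'
    by_cases h : i = i'
    · subst h; exact hA 1 i
    -- `hB` and `hC` give two combinations of the same two vectors, with coefficients i' + 2 and i +
    -- 2. Their difference isolates `τ 1`; this is why the base vectors have distinct slopes.
    · refine hsmul ((i : ℕ) - (i' : ℕ) : ℂ) _ ?_ ?_
      · rw [sub_ne_zero]
        exact fun h' => h (Fin.val_injective (Nat.cast_injective h'))
      · have := W.sub_mem (hC i'.succ.succ i) (hB i.succ.succ i')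
        convert this using 1
        module
  have hij' : ∀ i i' : Fin m, τ 0 i.succ.succ i'.succ.succ ∈ W := fun i i' =>
    (W.add_mem_iff_left (W.smul_mem _ (hij i i'))).1 (hB i.succ.succ i')
  match l with
  | 0 =>
    refine Fin.cases (hC1 k) (Fin.cases ?_ fun i => ?_) j
    · exact Fin.cases (hB1 _) (Fin.cases h011 h1i) k
    · exact Fin.cases (hB1 _) (Fin.cases (hi1 i) (hij' i)) k
  | 1 =>
    refine Fin.cases ?_ (Fin.cases ?_ fun i => ?_) j
    · exact Fin.cases (hA1 1) (Fin.cases h101 h0i) k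
    · exact Fin.cases h110 (Fin.cases hX h1i') k
    · exact Fin.cases (hi0 i) (Fin.cases (hi1' i) (hij i)) k

/-- The vectors in `ℂ²` of a point at which the tangent-secant family has maximal rank. -/
def baseVectors (m : ℕ) (i : Fin (m + 2)) : Fin 2 → ℂ :=
  ![if i = 1 then 0 else 1, (i : ℕ)]

/-- A point at which the tangent-secant family has maximal rank. -/
def baseParam (m : ℕ) : TangentSecantParam m → ℂ :=
  tangentSecantParam (baseVectors m) (fun i => Pi.single i 1) (fun i => Pi.single i 1)

/-- The tangent-secant family, with an arbitrary multiple of a coordinate vector added. -/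
def extendedFamily (m : ℕ) (q : (TangentSecantParam m → ℂ) × ℂ) :
    Fin 2 × Fin (m + 2) × Fin (m + 2) → ℂ :=
  tangentSecantFamily m q.1 + q.2 • Pi.single (1, 1, 1) 1

lemma contDiff_extendedFamily (m : ℕ) : ContDiff ℂ 1 (extendedFamily m) := by
  rw [contDiff_pi]
  intro t
  simp only [extendedFamily, tangentSecantFamily, tangentSecantArray, Pi.add_apply, Pi.smul_apply,
    smul_eq_mul]
  fun_prop

lemma fderiv_apply_eq_of_affine {E F : Type*} [NormedAddCommGroup E] [NormedSpace ℂ E]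
    [NormedAddCommGroup F] [NormedSpace ℂ F] {f : E → F} {x v : E} {w : F}
    (hf : DifferentiableAt ℂ f x) (h : ∀ s : ℂ, f (x + s • v) = f x + s • w) :
    fderiv ℂ f x v = w := by
  rw [← hf.lineDeriv_eq_fderiv, lineDeriv]
  simp only [h]
  have : HasDerivAt (fun s : ℂ => f x + s • w) ((1 : ℂ) • w) 0 :=
    ((hasDerivAt_id (0 : ℂ)).smul_const w).const_add _
  rw [this.deriv, one_smul]

lemma tangentSecantArray_add_left (s : ℂ) (a a' : Fin (m + 2) → Fin 2 → ℂ)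
    (b c : Fin (m + 2) → Fin (m + 2) → ℂ) :
    tangentSecantArray (a + s • a') b c =
      tangentSecantArray a b c + s • tangentSecantArray a' b c := by
  ext t
  simp only [tangentSecantArray, Pi.add_apply, Pi.smul_apply, smul_eq_mul, mul_add, Finset.mul_sum,
    add_mul, Finset.sum_add_distrib, mul_assoc]
  ring

lemma tangentSecantArray_add_mid (s : ℂ) (a : Fin (m + 2) → Fin 2 → ℂ)
    (b b' c : Fin (m + 2) → Fin (m + 2) → ℂ) :
    tangentSecantArray a (b + s • b') c =
      tangentSecantArray a b c + s • tangentSecantArray a b' c := by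
  ext t
  simp only [tangentSecantArray, Pi.add_apply, Pi.smul_apply, smul_eq_mul, mul_add, Finset.mul_sum,
    add_mul, Finset.sum_add_distrib, mul_assoc, mul_left_comm _ s]
  ring

lemma tangentSecantArray_add_right (s : ℂ) (a : Fin (m + 2) → Fin 2 → ℂ)
    (b c c' : Fin (m + 2) → Fin (m + 2) → ℂ) :
    tangentSecantArray a b (c + s • c') =
      tangentSecantArray a b c + s • tangentSecantArray a b c' := by
  ext t
  simp only [tangentSecantArray, Pi.add_apply, Pi.smul_apply, smul_eq_mul, mul_add, Finset.mul_sum,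
    Finset.sum_add_distrib, mul_assoc, mul_left_comm _ s]
  ring

lemma tangentSecantArray_single_succ_succ_left (i : Fin m) (v : Fin 2 → ℂ)
    (b c : Fin (m + 2) → Fin (m + 2) → ℂ) : tangentSecantArray (Pi.single i.succ.succ v) b c =
      pureTensor v (b i.succ.succ) (c i.succ.succ) := by
  have h0 : 0 ≠ i.succ.succ := (Fin.succ_ne_zero _).symm
  have h1 : 1 ≠ i.succ.succ := fun h => Fin.succ_ne_zero i (Fin.succ_injective _ h.symm)
  rw [tangentSecantArray_eq, Pi.single_eq_of_ne h0, Pi.single_eq_of_ne h1,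
    Finset.sum_eq_single i _ (by simp)]
  · simp
  · intro i' _ hi'
    rw [Pi.single_eq_of_ne fun h => hi' (Fin.succ_injective _ (Fin.succ_injective _ h))]
    simp

lemma tangentSecantArray_single_succ_succ_mid (i : Fin m) (v : Fin (m + 2) → ℂ)
    (a : Fin (m + 2) → Fin 2 → ℂ) (c : Fin (m + 2) → Fin (m + 2) → ℂ) :
    tangentSecantArray a (Pi.single i.succ.succ v) c =
      pureTensor (a i.succ.succ) v (c i.succ.succ) := by
  have h0 : 0 ≠ i.succ.succ := (Fin.succ_ne_zero _).symm
  have h1 : 1 ≠ i.succ.succ := fun h => Fin.succ_ne_zero i (Fin.succ_injective _ h.symm)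
  rw [tangentSecantArray_eq, Pi.single_eq_of_ne h0, Pi.single_eq_of_ne h1,
    Finset.sum_eq_single i _ (by simp)]
  · simp
  · intro i' _ hi'
    rw [Pi.single_eq_of_ne fun h => hi' (Fin.succ_injective _ (Fin.succ_injective _ h))]
    simp

lemma tangentSecantArray_single_succ_succ_right (i : Fin m) (v : Fin (m + 2) → ℂ)
    (a : Fin (m + 2) → Fin 2 → ℂ) (b : Fin (m + 2) → Fin (m + 2) → ℂ) :
    tangentSecantArray a b (Pi.single i.succ.succ v) =
      pureTensor (a i.succ.succ) (b i.succ.succ) v := by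
  have h0 : 0 ≠ i.succ.succ := (Fin.succ_ne_zero _).symm
  have h1 : 1 ≠ i.succ.succ := fun h => Fin.succ_ne_zero i (Fin.succ_injective _ h.symm)
  rw [tangentSecantArray_eq, Pi.single_eq_of_ne h0, Pi.single_eq_of_ne h1,
    Finset.sum_eq_single i _ (by simp)]
  · simp
  · intro i' _ hi'
    rw [Pi.single_eq_of_ne fun h => hi' (Fin.succ_injective _ (Fin.succ_injective _ h))]
    simp

/-- The family is affine in each of the blocks a, b, c, so the derivative along a block replaces
that block by the direction. With the added coordinate vector, these directions satisfy the
hypotheses of `mem_of_tangentSecant_directions`. -/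
lemma range_fderiv_extendedFamily (m : ℕ) :
    (fderiv ℂ (extendedFamily m) (baseParam m, 0)).range = ⊤ := by
  have hd : DifferentiableAt ℂ (extendedFamily m) (baseParam m, 0) :=
    (contDiff_extendedFamily m).contDiffAt.differentiableAt one_ne_zero
  set W := (fderiv ℂ (extendedFamily m) (baseParam m, 0)).range
  let b₀ : Fin (m + 2) → Fin (m + 2) → ℂ := fun i => Pi.single i 1
  have hmem : ∀ v w, (∀ s : ℂ, extendedFamily m ((baseParam m, 0) + s • v) =
      extendedFamily m (baseParam m, 0) + s • w) → w ∈ W := fun v w h =>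
    ⟨v, fderiv_apply_eq_of_affine hd h⟩
  have hA : ∀ a, tangentSecantArray a b₀ b₀ ∈ W := fun a => by
    refine hmem (tangentSecantParam a 0 0, 0) _ fun s => ?_
    have := tangentSecantArray_add_left s (baseVectors m) a b₀ b₀
    simp only [extendedFamily, Prod.smul_mk, Prod.mk_add_mk, smul_zero, add_zero, zero_smul]
    convert this using 1
    · ext t; simp [tangentSecantFamily, tangentSecantArray, baseParam, tangentSecantParam, b₀]
    · rfl
  have hB : ∀ b, tangentSecantArray (baseVectors m) b b₀ ∈ W := fun b => by
    refine hmem (tangentSecantParam 0 b 0, 0) _ fun s => ?_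
    have := tangentSecantArray_add_mid s (baseVectors m) b₀ b b₀
    simp only [extendedFamily, Prod.smul_mk, Prod.mk_add_mk, smul_zero, add_zero, zero_smul]
    convert this using 1
    · ext t; simp [tangentSecantFamily, tangentSecantArray, baseParam, tangentSecantParam, b₀]
    · rfl
  have hC : ∀ c, tangentSecantArray (baseVectors m) b₀ c ∈ W := fun c => by
    refine hmem (tangentSecantParam 0 0 c, 0) _ fun s => ?_
    have := tangentSecantArray_add_right s (baseVectors m) b₀ b₀ c
    simp only [extendedFamily, Prod.smul_mk, Prod.mk_add_mk, smul_zero, add_zero, zero_smul]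
    convert this using 1
    · ext t; simp [tangentSecantFamily, tangentSecantArray, baseParam, tangentSecantParam, b₀]
    · rfl
  have hX : (Pi.single (1, 1, 1) 1 : Fin 2 × Fin (m + 2) × Fin (m + 2) → ℂ) ∈ W := by
    refine hmem (0, 1) _ fun s => ?_
    simp [extendedFamily]
  let E : Fin 2 → Fin 2 → ℂ := fun l => Pi.single l 1
  have hv0 : baseVectors m 0 = E 0 := by
    ext l; fin_cases l <;> simp [baseVectors, E]
  have hv1 : baseVectors m 1 = E 1 := by
    ext l; fin_cases l <;> simp [baseVectors, E]
  have hvi : ∀ i : Fin m, baseVectors m i.succ.succ = E 0 + ((i : ℕ) + 2 : ℂ) • E 1 := by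
    intro i
    ext l
    fin_cases l
    · have : i.succ.succ ≠ 1 := fun h => Fin.succ_ne_zero _ (Fin.succ_injective _ h)
      simp [baseVectors, E, this]
    · simp [baseVectors, E]; ring
  have h10 : (0 : Fin (m + 2)) ≠ 1 := Fin.zero_ne_one
  have hs0 : ∀ i : Fin m, i.succ.succ ≠ 0 := fun i => Fin.succ_ne_zero _
  have hs1 : ∀ i : Fin m, i.succ.succ ≠ 1 := fun i h => Fin.succ_ne_zero _ (Fin.succ_injective _ h)
  have key := mem_of_tangentSecant_directions W (fun l j k => pureTensor (E l) (b₀ j) (b₀ k))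
    (fun l => by
      simpa [tangentSecantArray_eq, h10, h10.symm, hs0, hs1]
        using hA (Pi.single 1 (E l)))
    (fun l => by
      simpa [tangentSecantArray_eq, h10, h10.symm, hs0, hs1]
        using hA (Pi.single 0 (E l)))
    (fun l i => by
      have := hA (Pi.single i.succ.succ (E l))
      rwa [tangentSecantArray_single_succ_succ_left] at this)
    (fun j => by
      simpa [tangentSecantArray_eq, h10, h10.symm, hs0, hs1, hv0]
        using hB (Pi.single 1 (b₀ j)))
    (fun k => by
      simpa [tangentSecantArray_eq, h10, h10.symm, hs0, hs1, hv0]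
        using hC (Pi.single 1 (b₀ k)))
    (fun j => by
      simpa [tangentSecantArray_eq, h10, h10.symm, hs0, hs1, hv0, hv1]
        using hB (Pi.single 0 (b₀ j)))
    (fun k => by
      simpa [tangentSecantArray_eq, h10, h10.symm, hs0, hs1, hv0, hv1]
        using hC (Pi.single 0 (b₀ k)))
    (fun j i => by
      have := hB (Pi.single i.succ.succ (b₀ j))
      rwa [tangentSecantArray_single_succ_succ_mid, hvi,
        pureTensor_add_left, pureTensor_smul_left] at this)
    (fun k i => by
      have := hC (Pi.single i.succ.succ (b₀ k))
      rwa [tangentSecantArray_single_succ_succ_right, hvi,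
        pureTensor_add_left, pureTensor_smul_left] at this)
    (by simpa only [E, b₀, pureTensor_single] using hX)
  rw [eq_top_iff]
  rintro h -
  rw [← Finset.univ_sum_single h]
  refine W.sum_mem fun t _ => ?_
  have := W.smul_mem (h t) (key t.1 t.2.1 t.2.2)
  simp only [E, b₀, pureTensor_single] at this
  simpa [← Pi.single_smul] using this

/-- No nonzero polynomial which does not involve the last coordinate vanishes on the
tangent-secant family. -/
lemma eq_zero_of_rename_mem_vanishingIdeal
    (r : MvPolynomial {t : Fin 2 × Fin (m + 2) × Fin (m + 2) // t ≠ (1, 1, 1)} ℂ)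
    (hr : rename Subtype.val r ∈ vanishingIdeal ℂ (tangentSecantSet m)) : r = 0 := by
  have hmap := ((contDiff_extendedFamily m).contDiffAt.hasStrictFDerivAt
    one_ne_zero).map_nhds_eq_of_surj (range_fderiv_extendedFamily m)
  have h0 : rename Subtype.val r = 0 := by
    refine eq_zero_of_eventually_eval_eq_zero _ (extendedFamily m (baseParam m, 0)) ?_
    -- A submersion maps neighbourhoods onto neighbourhoods, and r does not see the added multiple
    -- of the (1,1,1) coordinate vector. Hence r vanishes on an open set.
    rw [← hmap, eventually_map]
    refine Eventually.of_forall fun q => ?_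
    have h1 : eval (tangentSecantFamily m q.1) (rename Subtype.val r) = 0 :=
      hr _ ⟨_, _, _, rfl⟩
    rw [eval_rename] at h1 ⊢
    convert h1 using 2
    congr 1
    ext t
    simp [extendedFamily, t.2]
  exact rename_injective _ Subtype.val_injective (by rw [h0, map_zero])

end TangentSecant

/-! ### Tangent spaces of the Segre variety and the cone over its dual -/

section Segre

open MvPolynomial

variable {l m n : ℕ}

lemma pureTensor_ne_zero {a : Fin l → ℂ} {b : Fin m → ℂ} {c : Fin n → ℂ} (ha : a ≠ 0) (hb : b ≠ 0)
    (hc : c ≠ 0) : pureTensor a b c ≠ 0 := by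
  obtain ⟨i, hi⟩ := Function.ne_iff.1 ha
  obtain ⟨j, hj⟩ := Function.ne_iff.1 hb
  obtain ⟨k, hk⟩ := Function.ne_iff.1 hc
  exact Function.ne_iff.2 ⟨(i, j, k), mul_ne_zero (mul_ne_zero hi hj) hk⟩

lemma exists_rep_eq_pureTensor {x : CProj (Fin l × Fin m × Fin n)} (hx : x ∈ segre l m n) :
    ∃ a b c, a ≠ 0 ∧ b ≠ 0 ∧ c ≠ 0 ∧ x.rep = pureTensor a b c := by
  obtain ⟨a, b, c, h, rfl⟩ := hx
  obtain ⟨s, hs⟩ := Projectivization.exists_smul_eq_mk_rep ℂ _ h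
  refine ⟨(s : ℂ) • a.rep, b.rep, c.rep, smul_ne_zero s.ne_zero a.rep_nonzero, b.rep_nonzero,
    c.rep_nonzero, ?_⟩
  rw [← hs, pureTensor_smul_left]
  rfl

lemma mk_pureTensor_mem_segre {a : Fin l → ℂ} {b : Fin m → ℂ} {c : Fin n → ℂ} (ha : a ≠ 0)
    (hb : b ≠ 0) (hc : c ≠ 0) :
    Projectivization.mk ℂ (pureTensor a b c) (pureTensor_ne_zero ha hb hc) ∈ segre l m n := by
  obtain ⟨r, hr⟩ := Projectivization.exists_smul_eq_mk_rep ℂ _ ha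
  obtain ⟨s, hs⟩ := Projectivization.exists_smul_eq_mk_rep ℂ _ hb
  obtain ⟨t, ht⟩ := Projectivization.exists_smul_eq_mk_rep ℂ _ hc
  refine ⟨Projectivization.mk ℂ a ha, Projectivization.mk ℂ b hb, Projectivization.mk ℂ c hc,
    pureTensor_ne_zero (Projectivization.rep_nonzero _) (Projectivization.rep_nonzero _)
      (Projectivization.rep_nonzero _), ?_⟩
  rw [eq_comm, Projectivization.mk_eq_mk_iff]
  refine ⟨r * s * t, ?_⟩
  rw [← hr, ← hs, ← ht]
  ext x
  simp only [pureTensor, Pi.smul_apply, Units.smul_def, smul_eq_mul, Units.val_mul]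
  ring

lemma eval_pureTensor_eq_zero {f : MvPolynomial (Fin l × Fin m × Fin n) ℂ}
    (hf : VanishesOn f (segre l m n)) {a : Fin l → ℂ} {b : Fin m → ℂ} {c : Fin n → ℂ} (ha : a ≠ 0)
    (hb : b ≠ 0) (hc : c ≠ 0) : eval (pureTensor a b c) f = 0 := by
  obtain ⟨⟨d, hd⟩, h⟩ := hf
  obtain ⟨s, hs⟩ := Projectivization.exists_smul_eq_mk_rep ℂ _ (pureTensor_ne_zero ha hb hc)
  have := h _ (mk_pureTensor_mem_segre ha hb hc)
  rw [← hs, Units.smul_def, eval_smul_of_isHomogeneous hd] at this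
  exact (mul_eq_zero.1 this).resolve_left (pow_ne_zero _ s.ne_zero)

section Derivative

variable {ι : Type} [Fintype ι]

/-- The derivative of a polynomial at `x` in the direction `v`. -/
noncomputable def dirDeriv (x v : ι → ℂ) (f : MvPolynomial ι ℂ) : ℂ :=
  ∑ i, eval x (pderiv i f) * v i

lemma dirDeriv_add (x v : ι → ℂ) (f g : MvPolynomial ι ℂ) :
    dirDeriv x v (f + g) = dirDeriv x v f + dirDeriv x v g := by
  simp only [dirDeriv, map_add, add_mul, Finset.sum_add_distrib]

lemma dirDeriv_sub (x v : ι → ℂ) (f g : MvPolynomial ι ℂ) :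
    dirDeriv x v (f - g) = dirDeriv x v f - dirDeriv x v g := by
  simp only [dirDeriv, map_sub, sub_mul, Finset.sum_sub_distrib]

lemma dirDeriv_mul (x v : ι → ℂ) (f g : MvPolynomial ι ℂ) :
    dirDeriv x v (f * g) = dirDeriv x v f * eval x g + eval x f * dirDeriv x v g := by
  simp only [dirDeriv, Derivation.leibniz, map_add, smul_eq_mul, map_mul, Finset.sum_mul,
    Finset.mul_sum, ← Finset.sum_add_distrib]
  exact Finset.sum_congr rfl fun i _ => by ring

lemma dirDeriv_X (x v : ι → ℂ) (i : ι) : dirDeriv x v (X i) = v i := by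
  classical
  simp [dirDeriv, pderiv_X, Pi.single_apply, apply_ite]

lemma hasDerivAt_eval (x v : ι → ℂ) (f : MvPolynomial ι ℂ) :
    HasDerivAt (fun s : ℂ => eval (x + s • v) f) (dirDeriv x v f) 0 := by
  induction f using MvPolynomial.induction_on with
  | C a => simpa [dirDeriv] using hasDerivAt_const (0 : ℂ) a
  | add f g hf hg =>
    rw [dirDeriv_add]
    simp only [map_add]
    exact hf.add hg
  | mul_X f i hf =>
    have hX : HasDerivAt (fun s : ℂ => eval (x + s • v) (X i)) (v i) 0 := by
      simpa using ((hasDerivAt_id (0 : ℂ)).mul_const (v i)).const_add (x i)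
    rw [dirDeriv_mul, dirDeriv_X]
    simp only [map_mul]
    have h := hf.mul hX
    simp only [zero_smul, add_zero] at h
    exact h

end Derivative

/-- A form vanishing on the Segre variety is zero along the line near s = 0, so its directional
derivative vanishes. -/
lemma mem_tangentSpace_of_line {x : CProj (Fin l × Fin m × Fin n)}
    {a : Fin l → ℂ} {b : Fin m → ℂ} {c : Fin n → ℂ} (hx : x.rep = pureTensor a b c)
    {v : Fin l × Fin m × Fin n → ℂ} (h : ∀ᶠ s in nhds (0 : ℂ), ∃ a' b' c',
      a' ≠ 0 ∧ b' ≠ 0 ∧ c' ≠ 0 ∧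
      pureTensor a b c + s • v = pureTensor a' b' c') : v ∈ tangentSpace (segre l m n) x := by
  intro f hf
  change dirDeriv x.rep v f = 0
  have h1 := hasDerivAt_eval x.rep v f
  have h2 : (fun s : ℂ => eval (x.rep + s • v) f) =ᶠ[nhds 0] fun _ => 0 := by
    filter_upwards [h]
    rintro s ⟨a', b', c', ha, hb, hc, he⟩
    rw [hx, he]
    exact eval_pureTensor_eq_zero hf ha hb hc
  exact h1.unique ((hasDerivAt_const (0 : ℂ) (0 : ℂ)).congr_of_eventuallyEq h2)

lemma eventually_add_smul_ne_zero {k : ℕ} {a : Fin k → ℂ} (ha : a ≠ 0) (a' : Fin k → ℂ) :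
    ∀ᶠ s in nhds (0 : ℂ), a + s • a' ≠ 0 := by
  have : Continuous fun s : ℂ => a + s • a' := by fun_prop
  exact this.continuousAt.eventually_ne (by simpa)

lemma tangent_mem_tangentSpace {x : CProj (Fin l × Fin m × Fin n)}
    {a : Fin l → ℂ} {b : Fin m → ℂ} {c : Fin n → ℂ} (ha : a ≠ 0) (hb : b ≠ 0) (hc : c ≠ 0)
    (hx : x.rep = pureTensor a b c) (a' : Fin l → ℂ) (b' : Fin m → ℂ) (c' : Fin n → ℂ) :
    pureTensor a' b c + pureTensor a b' c + pureTensor a b c' ∈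
      tangentSpace (segre l m n) x := by
  refine Submodule.add_mem _ (Submodule.add_mem _ ?_ ?_) ?_
  · refine mem_tangentSpace_of_line hx ((eventually_add_smul_ne_zero ha a').mono fun s hs => ?_)
    exact ⟨_, _, _, hs, hb, hc, by rw [pureTensor_add_left, pureTensor_smul_left]⟩
  · refine mem_tangentSpace_of_line hx ((eventually_add_smul_ne_zero hb b').mono fun s hs => ?_)
    exact ⟨_, _, _, ha, hs, hc, by rw [pureTensor_add_mid, pureTensor_smul_mid]⟩
  · refine mem_tangentSpace_of_line hx ((eventually_add_smul_ne_zero hc c').mono fun s hs => ?_)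
    exact ⟨_, _, _, ha, hb, hs, by rw [pureTensor_add_right, pureTensor_smul_right]⟩

/-- Differentiating a single type of cubic equation of the Segre variety, x(i,j,k) x(i₀,j₀,k₀)² =
x(i,j₀,k₀) x(i₀,j,k₀) x(i₀,j₀,k), expresses every entry of v by those differing from (i₀,j₀,k₀) in
at most one index. -/
lemma exists_eq_of_mem_tangentSpace {x : CProj (Fin l × Fin m × Fin n)}
    {a : Fin l → ℂ} {b : Fin m → ℂ} {c : Fin n → ℂ} (ha : a ≠ 0) (hb : b ≠ 0) (hc : c ≠ 0)
    (hx : x.rep = pureTensor a b c) {v : Fin l × Fin m × Fin n → ℂ}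
    (hv : v ∈ tangentSpace (segre l m n) x) :
    ∃ a' b' c', v = pureTensor a' b c + pureTensor a b' c + pureTensor a b c' := by
  obtain ⟨i₀, hi⟩ := Function.ne_iff.1 ha
  obtain ⟨j₀, hj⟩ := Function.ne_iff.1 hb
  obtain ⟨k₀, hk⟩ := Function.ne_iff.1 hc
  simp only [Pi.zero_apply] at hi hj hk
  have key : ∀ i j k, v (i, j, k) * (a i₀ * b j₀ * c k₀) ^ 2 +
      2 * (a i * b j * c k) * (a i₀ * b j₀ * c k₀) * v (i₀, j₀, k₀) =
      v (i, j₀, k₀) * (a i₀ * b j * c k₀) * (a i₀ * b j₀ * c k) +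
      (a i * b j₀ * c k₀) * v (i₀, j, k₀) * (a i₀ * b j₀ * c k) +
      (a i * b j₀ * c k₀) * (a i₀ * b j * c k₀) * v (i₀, j₀, k) := by
    intro i j k
    let f : MvPolynomial (Fin l × Fin m × Fin n) ℂ :=
      X (i, j, k) * (X (i₀, j₀, k₀) * X (i₀, j₀, k₀)) -
        X (i, j₀, k₀) * (X (i₀, j, k₀) * X (i₀, j₀, k))
    have hf : VanishesOn f (segre l m n) := by
      refine ⟨⟨3, ?_⟩, fun q hq => ?_⟩
      · exact ((isHomogeneous_X _ _).mul ((isHomogeneous_X _ _).mul (isHomogeneous_X _ _))).sub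
          ((isHomogeneous_X _ _).mul ((isHomogeneous_X _ _).mul (isHomogeneous_X _ _)))
      · obtain ⟨a, b, c, -, -, -, h⟩ := exists_rep_eq_pureTensor hq
        simp only [f, h, map_sub, map_mul, eval_X, pureTensor]
        ring
    have h := hv f hf
    change dirDeriv x.rep v f = 0 at h
    simp only [f, dirDeriv_sub, dirDeriv_mul, dirDeriv_X, map_mul, eval_X, hx, pureTensor] at h
    linear_combination h
  -- The term with the factor 2 compensates for `v (i₀, j₀, k₀)` being counted in all three
  -- summands.
  refine ⟨fun i => v (i, j₀, k₀) / (b j₀ * c k₀) - 2 * a i * v (i₀, j₀, k₀) / (a i₀ * b j₀ * c k₀),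
    fun j => v (i₀, j, k₀) / (a i₀ * c k₀), fun k => v (i₀, j₀, k) / (a i₀ * b j₀), ?_⟩
  ext ⟨i, j, k⟩
  simp only [pureTensor, Pi.add_apply]
  have h := key i j k
  field_simp
  refine mul_left_cancel₀ (mul_ne_zero (mul_ne_zero hi hj) hk) ?_
  linear_combination h

/-- The arrays `h` for which there are nonzero vectors whose pairwise contractions with `h`
vanish. -/
def contractionSet (l m n : ℕ) : Set (Fin l × Fin m × Fin n → ℂ) :=
  {h | ∃ (a : Fin l → ℂ) (b : Fin m → ℂ) (c : Fin n → ℂ), a ≠ 0 ∧ b ≠ 0 ∧ c ≠ 0 ∧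
    (∀ i, ∑ j, ∑ k, h (i, j, k) * b j * c k = 0) ∧
    (∀ j, ∑ i, ∑ k, h (i, j, k) * a i * c k = 0) ∧ ∀ k, ∑ i, ∑ j, h (i, j, k) * a i * b j = 0}

lemma sum_mul_pureTensor (h : Fin l × Fin m × Fin n → ℂ) (a : Fin l → ℂ) (b : Fin m → ℂ)
    (c : Fin n → ℂ) : ∑ t, h t * pureTensor a b c t =
      ∑ i, ∑ j, ∑ k, h (i, j, k) * a i * b j * c k := by
  simp only [Fintype.sum_prod_type, pureTensor, mul_assoc]

lemma sum_mul_pureTensor_left (h : Fin l × Fin m × Fin n → ℂ) (a : Fin l → ℂ) (b : Fin m → ℂ)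
    (c : Fin n → ℂ) : ∑ t, h t * pureTensor a b c t =
      ∑ i, a i * ∑ j, ∑ k, h (i, j, k) * b j * c k := by
  rw [sum_mul_pureTensor]
  simp only [Finset.mul_sum]
  exact Finset.sum_congr rfl fun i _ => Finset.sum_congr rfl fun j _ =>
    Finset.sum_congr rfl fun k _ => by ring

lemma sum_mul_pureTensor_mid (h : Fin l × Fin m × Fin n → ℂ) (a : Fin l → ℂ) (b : Fin m → ℂ)
    (c : Fin n → ℂ) : ∑ t, h t * pureTensor a b c t =
      ∑ j, b j * ∑ i, ∑ k, h (i, j, k) * a i * c k := by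
  rw [sum_mul_pureTensor, Finset.sum_comm]
  simp only [Finset.mul_sum]
  exact Finset.sum_congr rfl fun i _ => Finset.sum_congr rfl fun j _ =>
    Finset.sum_congr rfl fun k _ => by ring

lemma sum_mul_pureTensor_right (h : Fin l × Fin m × Fin n → ℂ) (a : Fin l → ℂ) (b : Fin m → ℂ)
    (c : Fin n → ℂ) : ∑ t, h t * pureTensor a b c t =
      ∑ k, c k * ∑ i, ∑ j, h (i, j, k) * a i * b j := by
  rw [sum_mul_pureTensor, (Finset.sum_congr rfl fun i _ => Finset.sum_comm).trans Finset.sum_comm]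
  simp only [Finset.mul_sum]
  exact Finset.sum_congr rfl fun i _ => Finset.sum_congr rfl fun j _ =>
    Finset.sum_congr rfl fun k _ => by ring

/-- The tangent space at a ⊗ b ⊗ c consists of the sums a' ⊗ b ⊗ c + a ⊗ b' ⊗ c + a ⊗ b ⊗ c', and
orthogonality to each summand is the vanishing of one contraction. -/
lemma mem_contractionSet_iff (h : Fin l × Fin m × Fin n → ℂ) :
    h ∈ contractionSet l m n ↔ ∃ x ∈ segre l m n, ∀ v ∈ tangentSpace (segre l m n) x,
      ∑ t, h t * v t = 0 := by
  constructor
  · rintro ⟨a, b, c, ha, hb, hc, h1, h2, h3⟩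
    obtain ⟨s, hs⟩ := Projectivization.exists_smul_eq_mk_rep ℂ _ (pureTensor_ne_zero ha hb hc)
    refine ⟨_, mk_pureTensor_mem_segre ha hb hc, fun v hv => ?_⟩
    rw [Units.smul_def, ← pureTensor_smul_left] at hs
    obtain ⟨a', b', c', rfl⟩ := exists_eq_of_mem_tangentSpace (smul_ne_zero s.ne_zero ha) hb hc
      hs.symm hv
    simp only [Pi.add_apply, mul_add, Finset.sum_add_distrib]
    rw [sum_mul_pureTensor_left, pureTensor_smul_left, pureTensor_smul_left]
    simp only [Pi.smul_apply, smul_eq_mul, mul_left_comm _ (s : ℂ), ← Finset.mul_sum]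
    rw [sum_mul_pureTensor_mid, sum_mul_pureTensor_right]
    simp only [h1, h2, h3, mul_zero, Finset.sum_const_zero, add_zero]
  · rintro ⟨x, hx, h⟩
    obtain ⟨a, b, c, ha, hb, hc, hrep⟩ := exists_rep_eq_pureTensor hx
    have ht := fun a' b' c' => h _ (tangent_mem_tangentSpace ha hb hc hrep a' b' c')
    refine ⟨a, b, c, ha, hb, hc, fun i => ?_, fun j => ?_, fun k => ?_⟩
    · simpa [sum_mul_pureTensor_left, Pi.single_apply] using ht (Pi.single i 1) 0 0
    · simpa [sum_mul_pureTensor_mid, Pi.single_apply] using ht 0 (Pi.single j 1) 0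
    · simpa [sum_mul_pureTensor_right, Pi.single_apply] using ht 0 0 (Pi.single k 1)

end Segre

/-! ### The chain of inclusions and the common irreducible generator -/

section Inclusions

open MvPolynomial

lemma pureTensor_dotProduct_pureTensor {l m n : ℕ} (a a' : Fin l → ℂ) (b b' : Fin m → ℂ)
    (c c' : Fin n → ℂ) : pureTensor a b c ⬝ᵥ pureTensor a' b' c' =
      (a ⬝ᵥ a') * (b ⬝ᵥ b') * (c ⬝ᵥ c') := by
  simp only [dotProduct, Fintype.sum_prod_type, pureTensor, Finset.sum_mul, Finset.mul_sum]
  symm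
  refine (Finset.sum_congr rfl fun k _ => Finset.sum_comm).trans (Finset.sum_comm.trans ?_)
  refine Finset.sum_congr rfl fun i _ => Finset.sum_comm.trans ?_
  exact Finset.sum_congr rfl fun j _ => Finset.sum_congr rfl fun k _ => by ring

lemma mem_contractionSet_of_dotProduct {l m n : ℕ} {h : Fin l × Fin m × Fin n → ℂ}
    {a : Fin l → ℂ} {b : Fin m → ℂ} {c : Fin n → ℂ} (ha : a ≠ 0) (hb : b ≠ 0) (hc : c ≠ 0)
    (h1 : ∀ a', h ⬝ᵥ pureTensor a' b c = 0) (h2 : ∀ b', h ⬝ᵥ pureTensor a b' c = 0)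
    (h3 : ∀ c', h ⬝ᵥ pureTensor a b c' = 0) : h ∈ contractionSet l m n := by
  simp only [dotProduct] at h1 h2 h3
  refine ⟨a, b, c, ha, hb, hc, fun i => ?_, fun j => ?_, fun k => ?_⟩
  · simpa [sum_mul_pureTensor_left, Pi.single_apply] using h1 (Pi.single i 1)
  · simpa [sum_mul_pureTensor_mid, Pi.single_apply] using h2 (Pi.single j 1)
  · simpa [sum_mul_pureTensor_right, Pi.single_apply] using h3 (Pi.single k 1)

lemma dotProduct_of_mem_contractionSet {l m n : ℕ} {h : Fin l × Fin m × Fin n → ℂ}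
    (hh : h ∈ contractionSet l m n) : ∃ (a : Fin l → ℂ) (b : Fin m → ℂ) (c : Fin n → ℂ),
      a ≠ 0 ∧ b ≠ 0 ∧ c ≠ 0 ∧ (∀ a', h ⬝ᵥ pureTensor a' b c = 0) ∧
      (∀ b', h ⬝ᵥ pureTensor a b' c = 0) ∧ ∀ c', h ⬝ᵥ pureTensor a b c' = 0 := by
  obtain ⟨a, b, c, ha, hb, hc, h1, h2, h3⟩ := hh
  simp only [dotProduct]
  refine ⟨a, b, c, ha, hb, hc, fun a' => ?_, fun b' => ?_, fun c' => ?_⟩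
  · simp [sum_mul_pureTensor_left, h1]
  · simp [sum_mul_pureTensor_mid, h2]
  · simp [sum_mul_pureTensor_right, h3]

lemma exists_ne_zero_dotProduct_eq_zero {k : ℕ} (b : Fin k → Fin (k + 1) → ℂ) :
    ∃ v, v ≠ 0 ∧ ∀ i, b i ⬝ᵥ v = 0 := by
  have h : (Matrix.mulVecLin (Matrix.of b)).ker ≠ ⊥ :=
    LinearMap.ker_ne_bot_of_finrank_lt (by simp)
  obtain ⟨v, hv, hv0⟩ := Submodule.exists_mem_ne_zero_of_ne_bot h
  exact ⟨v, hv0, fun i => congrFun hv i⟩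

variable {m : ℕ}

lemma tangentSecantArray_dotProduct (a : Fin (m + 2) → Fin 2 → ℂ)
    (b c : Fin (m + 2) → Fin (m + 2) → ℂ) (u : Fin 2 → ℂ) (v w : Fin (m + 2) → ℂ) :
    tangentSecantArray a b c ⬝ᵥ pureTensor u v w =
      (a 1 ⬝ᵥ u) * (b 0 ⬝ᵥ v) * (c 0 ⬝ᵥ w) + (a 0 ⬝ᵥ u) * (b 1 ⬝ᵥ v) * (c 0 ⬝ᵥ w) +
      (a 0 ⬝ᵥ u) * (b 0 ⬝ᵥ v) * (c 1 ⬝ᵥ w) + ∑ i : Fin m, (a i.succ.succ ⬝ᵥ u) *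
        (b i.succ.succ ⬝ᵥ v) * (c i.succ.succ ⬝ᵥ w) := by
  rw [tangentSecantArray_eq]
  simp only [add_dotProduct, sum_dotProduct, pureTensor_dotProduct_pureTensor]

/-- Choose u orthogonal to a 0, and v, w orthogonal to all b i, c i with i ≠ 1; these are m + 1
conditions in dimension m + 2. Every summand then has two vanishing pairings, so one survives when
u, v or w is replaced. -/
lemma tangentSecantSet_subset_contractionSet (m : ℕ) :
    tangentSecantSet m ⊆ contractionSet 2 (m + 2) (m + 2) := by
  rintro h ⟨a, b, c, rfl⟩
  obtain ⟨u, hu, hau⟩ := exists_ne_zero_dotProduct_eq_zero ![a 0]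
  obtain ⟨v, hv, hbv⟩ := exists_ne_zero_dotProduct_eq_zero
    (Fin.cons (b 0) fun i : Fin m => b i.succ.succ)
  obtain ⟨w, hw, hcw⟩ := exists_ne_zero_dotProduct_eq_zero
    (Fin.cons (c 0) fun i : Fin m => c i.succ.succ)
  have ha0 : a 0 ⬝ᵥ u = 0 := hau 0
  have hb0 : b 0 ⬝ᵥ v = 0 := hbv 0
  have hc0 : c 0 ⬝ᵥ w = 0 := hcw 0
  have hb : ∀ i : Fin m, b i.succ.succ ⬝ᵥ v = 0 := fun i => hbv i.succ
  have hc : ∀ i : Fin m, c i.succ.succ ⬝ᵥ w = 0 := fun i => hcw i.succ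
  refine mem_contractionSet_of_dotProduct hu hv hw (fun u' => ?_) (fun v' => ?_) (fun w' => ?_) <;>
  simp [tangentSecantArray_dotProduct, ha0, hb0, hc0, hb, hc]

/-- A nonzero vector is the first member of a basis. -/
lemma exists_basis_of_ne_zero {k : ℕ} {v : Fin (k + 1) → ℂ} (hv : v ≠ 0) :
    ∃ G V : Fin (k + 1) → Fin (k + 1) → ℂ, G 0 = v ∧
      ∀ i, (Pi.single i 1 : Fin (k + 1) → ℂ) = ∑ j, V i j • G j := by
  have h0 : (Pi.single 0 1 : Fin (k + 1) → ℂ) ≠ 0 := by simp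
  obtain ⟨A, hA⟩ := SeparatingDual.exists_continuousLinearEquiv_apply_eq (R := ℂ) h0 hv
  refine ⟨fun j => A (Pi.single j 1), fun i => A.symm (Pi.single i 1), hA, fun i => ?_⟩
  have := A.apply_symm_apply (Pi.single i 1)
  conv_lhs => rw [← this, ← Finset.univ_sum_single (A.symm (Pi.single i 1)), map_sum]
  refine Finset.sum_congr rfl fun j _ => ?_
  rw [← map_smul, ← Pi.single_smul, smul_eq_mul, mul_one]

lemma pureTensor_sum {l m n p q r : ℕ} (s : Fin p → ℂ) (a : Fin p → Fin l → ℂ) (t : Fin q → ℂ)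
    (b : Fin q → Fin m → ℂ) (u : Fin r → ℂ) (c : Fin r → Fin n → ℂ) :
    pureTensor (∑ i, s i • a i) (∑ j, t j • b j) (∑ k, u k • c k) =
      ∑ i, ∑ j, ∑ k, (s i * t j * u k) • pureTensor (a i) (b j) (c k) := by
  ext x
  simp only [pureTensor, Finset.sum_apply, Pi.smul_apply, smul_eq_mul, Finset.sum_mul,
    Finset.mul_sum]
  refine (Finset.sum_congr rfl fun k _ => Finset.sum_comm).trans (Finset.sum_comm.trans ?_)
  refine Finset.sum_congr rfl fun i _ => Finset.sum_comm.trans ?_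
  exact Finset.sum_congr rfl fun j _ => Finset.sum_congr rfl fun k _ => by ring

/-- Complete a, b, c to bases with index 0 for the given vectors. In these coordinates the entries
with two zero indices are values of the vanishing contractions. -/
lemma contractionSet_subset_degenerateSet (m : ℕ) :
    contractionSet 2 (m + 2) (m + 2) ⊆ degenerateSet m := by
  intro h hh
  obtain ⟨a, b, c, ha, hb, hc, h1, h2, h3⟩ := dotProduct_of_mem_contractionSet hh
  obtain ⟨A, g, rfl, hg⟩ := exists_basis_of_ne_zero ha
  obtain ⟨B, u, rfl, hu⟩ := exists_basis_of_ne_zero hb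
  obtain ⟨C, v, rfl, hv⟩ := exists_basis_of_ne_zero hc
  refine ⟨g, u, v, fun t => h ⬝ᵥ pureTensor (A t.1) (B t.2.1) (C t.2.2), ?_⟩
  ext ⟨i, j, k⟩
  have : h (i, j, k) = h ⬝ᵥ pureTensor (Pi.single i 1) (Pi.single j 1) (Pi.single k 1) := by
    rw [pureTensor_single, dotProduct_single, mul_one]
  rw [this, hg, hu, hv, pureTensor_sum]
  simp only [dotProduct_sum, dotProduct_smul, smul_eq_mul, degenerateArray]
  refine Finset.sum_congr rfl fun i' _ => Finset.sum_congr rfl fun j' _ =>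
    Finset.sum_congr rfl fun k' _ => ?_
  congr 1
  split_ifs with hd
  · rcases hd with ⟨rfl, rfl⟩ | ⟨rfl, rfl⟩ | ⟨rfl, rfl⟩
    exacts [h3 _, h2 _, h1 _]
  · rfl

lemma smul_mem_tangentSecantSet {h : Fin 2 × Fin (m + 2) × Fin (m + 2) → ℂ}
    (hh : h ∈ tangentSecantSet m) (s : ℂ) : s • h ∈ tangentSecantSet m := by
  obtain ⟨a, b, c, rfl⟩ := hh
  refine ⟨s • a, b, c, ?_⟩
  ext t
  simp only [tangentSecantArray, Pi.smul_apply, smul_eq_mul, mul_add, Finset.mul_sum, mul_assoc]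

/-- The ideal of the tangent-secant arrays is generated by an irreducible form, which vanishes on
the arrays with degenerate contractions as well. -/
lemma exists_irreducible_generator (m : ℕ) :
    ∃ (F : MvPolynomial (Fin 2 × Fin (m + 2) × Fin (m + 2)) ℂ) (d : ℕ), F.IsHomogeneous d ∧
      Irreducible F ∧ vanishingIdeal ℂ (tangentSecantSet m) = Ideal.span {F} ∧
      F ∈ vanishingIdeal ℂ (contractionSet 2 (m + 2) (m + 2)) := by
  have hle : vanishingIdeal ℂ (degenerateSet m) ≤ vanishingIdeal ℂ (tangentSecantSet m) :=
    fun f hf x hx => hf x (contractionSet_subset_degenerateSet m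
      (tangentSecantSet_subset_contractionSet m hx))
  obtain ⟨F, hF, hspan⟩ := exists_irreducible_span (1, 1, 1) (vanishingIdeal ℂ (degenerateSet m))
    (vanishingIdeal_degenerateSet_ne_bot m)
    fun r hr => eq_zero_of_rename_mem_vanishingIdeal r (hle hr)
  obtain ⟨F', hF', hspan'⟩ := exists_irreducible_span (1, 1, 1)
    (vanishingIdeal ℂ (tangentSecantSet m))
    (ne_bot_of_le_ne_bot (vanishingIdeal_degenerateSet_ne_bot m) hle)
    eq_zero_of_rename_mem_vanishingIdeal
  have hFm : F ∈ vanishingIdeal ℂ (degenerateSet m) := by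
    rw [hspan]; exact Ideal.mem_span_singleton_self F
  have hdvd : F' ∣ F := by
    rw [← Ideal.mem_span_singleton, ← hspan']
    exact hle hFm
  -- This is where the squeeze closes: the two prime ideals coincide.
  have hassoc : Associated F' F := hF'.associated_of_dvd hF hdvd
  rw [Ideal.span_singleton_eq_span_singleton.2 hassoc] at hspan'
  obtain ⟨d, hd⟩ := exists_isHomogeneous_of_vanishingIdeal_eq_span (tangentSecantSet m)
    (fun x hx s => smul_mem_tangentSecantSet hx s) F hF.ne_zero hspan'
  exact ⟨F, d, hd, hF, hspan', fun x hx => hFm x (contractionSet_subset_degenerateSet m hx)⟩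

end Inclusions

/-! ### The join and the dual variety as the zero set of the generator -/

section Main

open MvPolynomial Filter Topology

variable {m : ℕ}

/-- The pullback of f to the parameter space is a polynomial vanishing on an open set. This permits
discarding parameters whose arrays or vectors vanish and give no projective point. -/
lemma mem_vanishingIdeal_of_eventually
    {f : MvPolynomial (Fin 2 × Fin (m + 2) × Fin (m + 2)) ℂ}
    (h : ∀ᶠ p in 𝓝 (baseParam m), eval (tangentSecantFamily m p) f = 0) :
    f ∈ vanishingIdeal ℂ (tangentSecantSet m) := by
  let Q : MvPolynomial (TangentSecantParam m) ℂ := aeval (tangentSecantFamily m X) f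
  have hQ : ∀ p, eval p Q = eval (tangentSecantFamily m p) f := fun p => by
    simp only [Q, eval_aeval, eval_tangentSecantFamily]
  have hQ0 : Q = 0 :=
    eq_zero_of_eventually_eval_eq_zero Q (baseParam m) (by simpa only [hQ] using h)
  rw [tangentSecantSet_eq_range, mem_vanishingIdeal_iff, Set.forall_mem_range]
  intro p
  simp only [eval_tangentSecantFamily]
  change eval _ f = 0
  rw [← hQ, hQ0, map_zero]

lemma continuous_tangentSecantFamily (m : ℕ) :
    Continuous (tangentSecantFamily m : (TangentSecantParam m → ℂ) → _) := by
  refine continuous_pi fun t => ?_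
  simp only [tangentSecantFamily, tangentSecantArray]
  fun_prop

lemma tangentSecantFamily_baseParam_ne_zero (m : ℕ) :
    tangentSecantFamily m (baseParam m) ≠ 0 := by
  refine Function.ne_iff.2 ⟨(1, 0, 0), ?_⟩
  simp [tangentSecantFamily, tangentSecantArray, baseParam, tangentSecantParam, baseVectors]

lemma eventually_tangentSecantFamily_ne_zero (m : ℕ) :
    ∀ᶠ p in 𝓝 (baseParam m), tangentSecantFamily m p ≠ 0 :=
  (continuous_tangentSecantFamily m).continuousAt.eventually_ne
    (tangentSecantFamily_baseParam_ne_zero m)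

lemma eval_eq_zero_of_eval_rep_mk {ι : Type} {f : MvPolynomial ι ℂ} {d : ℕ}
    (hf : f.IsHomogeneous d) {v : ι → ℂ} (hv : v ≠ 0)
    (h : eval (Projectivization.mk ℂ v hv).rep f = 0) : eval v f = 0 := by
  obtain ⟨s, hs⟩ := Projectivization.exists_smul_eq_mk_rep ℂ v hv
  rw [← hs, Units.smul_def, eval_smul_of_isHomogeneous hf] at h
  exact (mul_eq_zero.1 h).resolve_left (pow_ne_zero _ s.ne_zero)

lemma dualVariety_segre_eq_zeroSet {F : MvPolynomial (Fin 2 × Fin (m + 2) × Fin (m + 2)) ℂ} {d : ℕ}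
    (hd : F.IsHomogeneous d) (hspan : vanishingIdeal ℂ (tangentSecantSet m) = Ideal.span {F})
    (hF : F ∈ vanishingIdeal ℂ (contractionSet 2 (m + 2) (m + 2))) :
    dualVariety (segre 2 (m + 2) (m + 2)) = zeroSet F := by
  refine zariskiClosure_eq_zeroSet hd (fun h hh => ?_) fun f hf => ?_
  · exact hF _ ((mem_contractionSet_iff _).2 hh)
  · rw [← Ideal.mem_span_singleton, ← hspan]
    refine mem_vanishingIdeal_of_eventually ?_
    obtain ⟨⟨e, he⟩, hf⟩ := hf
    filter_upwards [eventually_tangentSecantFamily_ne_zero m] with p hp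
    refine eval_eq_zero_of_eval_rep_mk he hp (hf _ ((mem_contractionSet_iff _).1 ?_))
    obtain ⟨s, hs⟩ := Projectivization.exists_smul_eq_mk_rep ℂ _ hp
    rw [← hs]
    exact tangentSecantSet_subset_contractionSet m
      (smul_mem_tangentSecantSet (s := (s : ℂ)) ⟨_, _, _, rfl⟩)

lemma subset_zariskiClosure {ι : Type} (Y : Set (CProj ι)) : Y ⊆ zariskiClosure Y :=
  fun _ hq _ hf => hf.2 _ hq

/-- A polynomial vanishing on all sums of a vector `y` and a vector of the cone over `Z` vanishes on
all sums of `y` and a vector of the cone over the closure of `Z`. -/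
lemma eval_add_smul_rep_eq_zero {ι : Type} {Z : Set (CProj ι)} {F : MvPolynomial ι ℂ} (y : ι → ℂ)
    (h : ∀ q ∈ Z, ∀ c : ℂ, eval (y + c • q.rep) F = 0) {p : CProj ι} (hp : p ∈ zariskiClosure Z)
    (c : ℂ) : eval (y + c • p.rep) F = 0 := by
  let G : MvPolynomial ι ℂ := aeval (fun t => C (y t) + X t) F
  have hG : ∀ v, eval v G = eval (y + v) F := fun v => by
    simp only [G, eval_aeval, map_add, eval_C, eval_X]
    rfl
  rw [← hG]
  exact eval_smul_rep_eq_zero_of_mem_zariskiClosure (fun q hq c => by rw [hG]; exact h q hq c) hp c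

lemma submodule_le_iff {ι : Type} (p : CProj ι) (W : Submodule ℂ (ι → ℂ)) :
    p.submodule ≤ W ↔ p.rep ∈ W := by
  rw [Projectivization.submodule_eq, Submodule.span_singleton_le_iff_mem]

lemma iSup_submodule_eq_span {ι κ : Type} (x : κ → CProj ι) :
    ⨆ i, (x i).submodule = Submodule.span ℂ (Set.range fun i => (x i).rep) := by
  simp only [Projectivization.submodule_eq, Submodule.span_range_eq_iSup]

lemma add_mem_tangentSecantSet (a₀ a' : Fin 2 → ℂ) (b₀ b' c₀ c' : Fin (m + 2) → ℂ)
    (a : Fin m → Fin 2 → ℂ) (b c : Fin m → Fin (m + 2) → ℂ) :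
    pureTensor a' b₀ c₀ + pureTensor a₀ b' c₀ + pureTensor a₀ b₀ c' +
      ∑ i, pureTensor (a i) (b i) (c i) ∈ tangentSecantSet m := by
  refine ⟨Fin.cons a₀ (Fin.cons a' a), Fin.cons b₀ (Fin.cons b' b), Fin.cons c₀ (Fin.cons c' c), ?_⟩
  rw [tangentSecantArray_eq]
  rfl

lemma eval_rep_eq_zero_of_mem_join {F : MvPolynomial (Fin 2 × Fin (m + 2) × Fin (m + 2)) ℂ}
    (hF : F ∈ vanishingIdeal ℂ (tangentSecantSet m))
    {p : CProj (Fin 2 × Fin (m + 2) × Fin (m + 2))}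
    (hp : p ∈ tangentialVariety (segre 2 (m + 2) (m + 2)) ∪
      secantVariety m (segre 2 (m + 2) (m + 2)) ∪
      {p | ∃ y ∈ tangentialVariety (segre 2 (m + 2) (m + 2)),
        ∃ z ∈ secantVariety m (segre 2 (m + 2) (m + 2)),
        p.submodule ≤ y.submodule ⊔ z.submodule}) : eval p.rep F = 0 := by
  -- The join is formed from two closed varieties, so closures are passed one summand at a time:
  -- `hτ` fixes the secant part as an explicit sum, then `hσ` fixes the tangential part.
  have hτ : ∀ (a : Fin m → Fin 2 → ℂ) (b c : Fin m → Fin (m + 2) → ℂ),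
      ∀ y ∈ tangentialVariety (segre 2 (m + 2) (m + 2)), ∀ s : ℂ,
      eval (∑ i : Fin m, pureTensor (a i) (b i) (c i) + s • y.rep) F = 0 := by
    intro a b c y hy s
    refine eval_add_smul_rep_eq_zero _ ?_ hy s
    rintro q ⟨x, hx, hq⟩ s
    obtain ⟨a₀, b₀, c₀, ha, hb, hc, hrep⟩ := exists_rep_eq_pureTensor hx
    rw [submodule_le_iff] at hq
    obtain ⟨a', b', c', h⟩ := exists_eq_of_mem_tangentSpace ha hb hc hrep
      (Submodule.smul_mem _ s hq)
    rw [h, add_comm (Finset.sum _ _)]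
    exact hF _ (add_mem_tangentSecantSet _ _ _ _ _ _ _ _ _)
  have hτ' : ∀ y ∈ tangentialVariety (segre 2 (m + 2) (m + 2)), ∀ s : ℂ,
      eval (s • y.rep) F = 0 := by
    intro y hy s
    simpa using hτ 0 0 0 y hy s
  have hσ : ∀ v, (∀ (a : Fin m → Fin 2 → ℂ) (b c : Fin m → Fin (m + 2) → ℂ),
        eval (∑ i : Fin m, pureTensor (a i) (b i) (c i) + v) F = 0) →
      ∀ z ∈ secantVariety m (segre 2 (m + 2) (m + 2)), ∀ s : ℂ, eval (v + s • z.rep) F = 0 := by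
    intro v hv z hz s
    refine eval_add_smul_rep_eq_zero _ ?_ hz s
    rintro q ⟨x, hx, hq⟩ s
    rw [submodule_le_iff, iSup_submodule_eq_span] at hq
    obtain ⟨w, hw⟩ := (Submodule.mem_span_range_iff_exists_fun ℂ).1 (Submodule.smul_mem _ s hq)
    choose a b c _ _ _ hrep using fun i => exists_rep_eq_pureTensor (hx i)
    rw [← hw, add_comm v]
    simp only [hrep, ← pureTensor_smul_left]
    exact hv _ _ _
  rcases hp with (hp | hp) | ⟨y, hy, z, hz, hp⟩
  · simpa using hτ' p hp 1
  · have h0 : ∀ (a : Fin m → Fin 2 → ℂ) (b c : Fin m → Fin (m + 2) → ℂ),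
        eval (∑ i : Fin m, pureTensor (a i) (b i) (c i) + 0) F = 0 := by
      intro a b c
      have := hF _ (add_mem_tangentSecantSet 0 0 0 0 0 0 a b c)
      simpa using this
    simpa using hσ 0 h0 p hp 1
  · rw [submodule_le_iff, Submodule.mem_sup] at hp
    obtain ⟨y', hy', z', hz', h⟩ := hp
    rw [Projectivization.submodule_eq, Submodule.mem_span_singleton] at hy' hz'
    obtain ⟨s, rfl⟩ := hy'
    obtain ⟨t, rfl⟩ := hz'
    rw [← h]
    exact hσ _ (fun a b c => hτ a b c y hy s) z hz t

lemma join_segre_eq_zeroSet {F : MvPolynomial (Fin 2 × Fin (m + 2) × Fin (m + 2)) ℂ} {d : ℕ}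
    (hd : F.IsHomogeneous d) (hspan : vanishingIdeal ℂ (tangentSecantSet m) = Ideal.span {F}) :
    join (tangentialVariety (segre 2 (m + 2) (m + 2)))
      (secantVariety m (segre 2 (m + 2) (m + 2))) = zeroSet F := by
  have hF : F ∈ vanishingIdeal ℂ (tangentSecantSet m) := by
    rw [hspan]; exact Ideal.mem_span_singleton_self F
  refine zariskiClosure_eq_zeroSet hd (fun p hp => eval_rep_eq_zero_of_mem_join hF hp)
    fun f hf => ?_
  rw [← Ideal.mem_span_singleton, ← hspan]
  refine mem_vanishingIdeal_of_eventually ?_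
  obtain ⟨⟨e, he⟩, hf⟩ := hf
  have hbase : ∀ i, baseVectors m i ≠ 0 := by
    intro i h
    by_cases hi : i = 1
    · subst hi
      have := congrFun h 1
      simp [baseVectors] at this
    · have := congrFun h 0
      simp [baseVectors, hi] at this
  have hA : ∀ᶠ p in 𝓝 (baseParam m), ∀ i, (fun j => p (.inl (i, j))) ≠ 0 := by
    refine eventually_all.2 fun i => ?_
    have hc : Continuous fun (p : TangentSecantParam m → ℂ) j => p (.inl (i, j)) := by fun_prop
    exact hc.continuousAt.eventually_ne (hbase i)
  have hB : ∀ᶠ p in 𝓝 (baseParam m), ∀ i, (fun j => p (.inr (.inl (i, j)))) ≠ 0 := by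
    refine eventually_all.2 fun i => ?_
    have hc : Continuous fun (p : TangentSecantParam m → ℂ) j => p (.inr (.inl (i, j))) := by
      fun_prop
    refine hc.continuousAt.eventually_ne (y := (0 : Fin (m + 2) → ℂ)) ?_
    exact (Pi.single_ne_zero_iff (i := i)).2 (one_ne_zero (α := ℂ))
  have hC : ∀ᶠ p in 𝓝 (baseParam m), ∀ i, (fun j => p (.inr (.inr (i, j)))) ≠ 0 := by
    refine eventually_all.2 fun i => ?_
    have hc : Continuous fun (p : TangentSecantParam m → ℂ) j => p (.inr (.inr (i, j))) := by
      fun_prop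
    refine hc.continuousAt.eventually_ne (y := (0 : Fin (m + 2) → ℂ)) ?_
    exact (Pi.single_ne_zero_iff (i := i)).2 (one_ne_zero (α := ℂ))
  -- This is the (1,0,0) entry of the tangential part, equal to 1 at the base parameter.
  have hT : ∀ᶠ p in 𝓝 (baseParam m), p (.inl (1, 1)) * p (.inr (.inl (0, 0))) *
      p (.inr (.inr (0, 0))) + p (.inl (0, 1)) * p (.inr (.inl (1, 0))) * p (.inr (.inr (0, 0))) +
      p (.inl (0, 1)) * p (.inr (.inl (0, 0))) * p (.inr (.inr (1, 0))) ≠ 0 := by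
    refine ContinuousAt.eventually_ne (by fun_prop) ?_
    simp [baseParam, tangentSecantParam, baseVectors]
  filter_upwards [eventually_tangentSecantFamily_ne_zero m, hA, hB, hC, hT] with p hp hA hB hC hT
  refine eval_eq_zero_of_eval_rep_mk he hp (hf _ ?_)
  set a : Fin (m + 2) → Fin 2 → ℂ := fun i j => p (.inl (i, j)) with ha
  set b : Fin (m + 2) → Fin (m + 2) → ℂ := fun i j => p (.inr (.inl (i, j))) with hb
  set c : Fin (m + 2) → Fin (m + 2) → ℂ := fun i j => p (.inr (.inr (i, j))) with hc
  set y := pureTensor (a 1) (b 0) (c 0) + pureTensor (a 0) (b 1) (c 0) +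
    pureTensor (a 0) (b 0) (c 1) with hy
  set z := ∑ i : Fin m, pureTensor (a i.succ.succ) (b i.succ.succ) (c i.succ.succ) with hz
  have hyz : tangentSecantFamily m p = y + z := tangentSecantArray_eq a b c
  have hy0 : y ≠ 0 := Function.ne_iff.2 ⟨(1, 0, 0), hT⟩
  have hyτ : ∃ x ∈ segre 2 (m + 2) (m + 2), y ∈ tangentSpace (segre 2 (m + 2) (m + 2)) x := by
    obtain ⟨s, hs⟩ := Projectivization.exists_smul_eq_mk_rep ℂ _
      (pureTensor_ne_zero (hA 0) (hB 0) (hC 0))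
    refine ⟨_, mk_pureTensor_mem_segre (hA 0) (hB 0) (hC 0), ?_⟩
    rw [Units.smul_def, ← pureTensor_smul_left] at hs
    -- The representative carries a scalar s on a 0, so b 1 and c 1 are divided by s to compensate.
    have := tangent_mem_tangentSpace (smul_ne_zero s.ne_zero (hA 0)) (hB 0) (hC 0) hs.symm (a 1)
      ((s : ℂ)⁻¹ • b 1) ((s : ℂ)⁻¹ • c 1)
    rw [pureTensor_smul_left, pureTensor_smul_left, pureTensor_smul_mid, pureTensor_smul_right,
      smul_inv_smul₀ s.ne_zero, smul_inv_smul₀ s.ne_zero] at this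
    exact this
  obtain ⟨x, hx, hyx⟩ := hyτ
  -- A zero secant part defines no projective point; this always happens for m = 0, where the secant
  -- variety is empty.
  by_cases hz0 : z = 0
  · refine Or.inl (Or.inl (subset_zariskiClosure _ ⟨x, hx, ?_⟩))
    rw [Projectivization.submodule_mk, Submodule.span_singleton_le_iff_mem, hyz, hz0, add_zero]
    exact hyx
  · refine Or.inr ⟨Projectivization.mk ℂ y hy0, subset_zariskiClosure _ ⟨x, hx, ?_⟩,
      Projectivization.mk ℂ z hz0, subset_zariskiClosure _
        ⟨fun i => Projectivization.mk ℂ _ (pureTensor_ne_zero (hA i.succ.succ) (hB i.succ.succ)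
          (hC i.succ.succ)), fun i => mk_pureTensor_mem_segre (hA _) (hB _) (hC _), ?_⟩, ?_⟩
    · rwa [Projectivization.submodule_mk, Submodule.span_singleton_le_iff_mem]
    · rw [Projectivization.submodule_mk, Submodule.span_singleton_le_iff_mem]
      refine Submodule.sum_mem _ fun i _ => Submodule.mem_iSup_of_mem i ?_
      rw [Projectivization.submodule_mk]
      exact Submodule.mem_span_singleton_self _
    · simp only [Projectivization.submodule_mk]
      rw [Submodule.span_singleton_le_iff_mem, hyz]
      exact Submodule.add_mem_sup (Submodule.mem_span_singleton_self _)
        (Submodule.mem_span_singleton_self _)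

end Main

end ProjVar

theorem mainTheorem5 (n : ℕ) (hn : 2 ≤ n) :
    ProjVar.join (ProjVar.tangentialVariety (ProjVar.segre 2 n n))
        (ProjVar.secantVariety (n - 2) (ProjVar.segre 2 n n)) =
      ProjVar.dualVariety (ProjVar.segre 2 n n) ∧
    ProjVar.IsIrreducibleHypersurface (ProjVar.dualVariety (ProjVar.segre 2 n n)) := by
  obtain ⟨m, rfl⟩ := Nat.exists_eq_add_of_le' hn
  obtain ⟨F, d, hd, hirr, hspan, hF⟩ := ProjVar.exists_irreducible_generator m
  rw [Nat.add_sub_cancel, ProjVar.join_segre_eq_zeroSet hd hspan,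
    ProjVar.dualVariety_segre_eq_zeroSet hd hspan hF]
  exact ⟨rfl, F, d, hd, hirr, rfl⟩
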